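/- Let $\Omega=(0,1)$ and $\mathbb K\in\{\mathbb R,\mathbb C\}$; functions are $\mathbb K$-valued, $(u,v)=\int_\Omega u\overline v$, and $\|\cdot\|$ is the $L^2(\Omega)$ norm. For $0<s<1/2$ put $$\|v\|_{H^s(\Omega)}^2=\|v\|^2+\int_{\Omega\times\Omega}\frac{|v(x)-v(y)|^2}{|x-y|^{1+2s}}\,dx\,dy,\qquad \|u\|_{H^{-s}(\Omega)}=\sup_{v\in H^s(\Omega)\setminus\{0\}}\frac{|(u,v)|}{\|v\|_{H^s(\Omega)}} .$$ Let $0=x_0<x_1<\dots<x_N=1$ be a mesh with elements $\mathcal T=\{\tau_i=[x_{i-1},x_i]\}$, lengths $h_\tau$, $h=\max_\tau h_\tau$, quasi-uniformity constant $C_{\rm qu}=\max_\tau h/h_\tau$ and $C_{\mathcal T}=\max\{h_\tau/h_\sigma:\tau\cap\sigma\ne\emptyset\}$. For $m\ge 0$ let $S^m_{\mathcal T}$ be the space of functions that are polynomials of degree at most $m$ on each element and, if $m\ge1$, are continuous on $[0,1]$. Let $(b_i)_{i=1}^M$ be its Lagrange basis for the nodal points that are the midpoints of the elements if $m=0$,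 and the $m+1$ equispaced points, end points included, of each element if $m\geq 1$. Put $\mathcal I_\tau=\{i:\tau\subset\operatorname{supp}b_i\}$. Let $0<\alpha<1$ and let $K$ be a real kernel such that $(x-y)^{\alpha-1}K(x,y)$ is integrable on $\{0<y<x<1\}$ (for instance $K$ bounded and measurable). Let $$a_{K,\alpha}(u,v)=\frac1{\Gamma(\alpha)}\int_0^1\Big(\int_0^x (x-y)^{\alpha-1}K(x,y)u(y)\,dy\Big)\overline{v(x)}\,dx ,$$ $$I^{i,j}_{\tau\times\sigma}=\int_\tau\int_{\sigma\cap[0,x]}b_i(x)b_j(y)K(x,y)(x-y)^{\alpha-1}\,dy\,dx ,$$ let $Q^{i,j}_{\tau\times\sigma}\in\mathbb R$ be arbitrary (quadrature) approximations of $I^{i,j}_{\tau\times\sigma}$, and for $u=\sum_i\alpha_ib_i$, $v=\sum_i\beta_ib_i$ let $$\tilde a_{K,\alpha}(u,v)=\sum_{i,j=1}^M\overline{\beta_i}\,\tilde a_{i,j}\,\alpha_j,\qquad \tilde a_{i,j}=\frac1{\Gamma(\alpha)}\sum_{\tau\subset\operatorname{supp}b_i}\ \sum_{\sigma\subset\operatorname{supp}b_j}Q^{i,j}_{\tau\times\sigma}.$$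 Let $E^{\max}_{\tau\times\sigma}=\max\{|I^{i,j}_{\tau\times\sigma}-Q^{i,j}_{\tau\times\sigma}|:(i,j)\in\mathcal I_\tau\times\mathcal I_\sigma\}$. Then there are positive constants $C_m$, depending only on $m$, and $C_{\rm inv}=C_{\rm inv}(s,m,C_{\mathcal T},C_{\rm qu})$ such that the inverse inequality $\|u\|\le C_{\rm inv}h^{-s}\|u\|_{H^{-s}(\Omega)}$ holds for all $u\in S^m_{\mathcal T}$, $0<s<1/2$, $m\ge0$ and all meshes, and such that, with $C_{\rm inv}$ taken at $s=\alpha/2$ and $$E^{\max}_{K,\alpha}:=C_m\,C_{\rm qu}\,C_{\rm inv}^2\max_{\tau,\sigma\in\mathcal T}E^{\max}_{\tau\times\sigma},$$ for all $\alpha$, $m$, meshes, kernels $K$ and approximations $Q$ as above and all $u,v\in S^m_{\mathcal T}$, $$|a_{K,\alpha}(u,v)-\tilde a_{K,\alpha}(u,v)|\le E^{\max}_{K,\alpha}\,h^{-2-\alpha}\,\|u\|_{H^{-\alpha/2}(\Omega)}\|v\|_{H^{-\alpha/2}(\Omega)} .$$ -/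

import Mathlib

open MeasureTheory Set Polynomial

noncomputable section

namespace AbelFEM

/-! ### Sobolev norms of fractional order on `Ω = (0, 1)` -/

/-- The interval `Ω = (0, 1)`. -/
def Om : Set ℝ := Ioo 0 1

/-- The `L²(Ω)` scalar product `(u, v) = ∫_Ω u v̄`. -/
def l2inner {𝕜 : Type*} [RCLike 𝕜] (u v : ℝ → 𝕜) : 𝕜 :=
  ∫ x in Om, u x * (starRingEnd 𝕜) (v x)

/-- The `L²(Ω)` norm. -/
def l2norm {𝕜 : Type*} [RCLike 𝕜] (u : ℝ → 𝕜) : ℝ :=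
  Real.sqrt (∫ x in Om, ‖u x‖ ^ 2)

/-- The integrand of the squared Slobodeckij seminorm of order `s ∈ (0, 1)`. -/
def slobIntegrand {𝕜 : Type*} [RCLike 𝕜] (s : ℝ) (v : ℝ → 𝕜) (p : ℝ × ℝ) : ℝ :=
  ‖v p.1 - v p.2‖ ^ 2 / |p.1 - p.2| ^ (1 + 2 * s)

/-- Membership in `H^s(Ω)` for `s ∈ (0, 1)`. -/
def MemHs {𝕜 : Type*} [RCLike 𝕜] (s : ℝ) (v : ℝ → 𝕜) : Prop :=
  MemLp v 2 (volume.restrict Om) ∧ IntegrableOn (slobIntegrand s v) (Om ×ˢ Om)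

/-- The norm of `H^s(Ω)` for `s ∈ (0, 1)`. -/
def HsNorm {𝕜 : Type*} [RCLike 𝕜] (s : ℝ) (v : ℝ → 𝕜) : ℝ :=
  Real.sqrt ((∫ x in Om, ‖v x‖ ^ 2) + ∫ p in Om ×ˢ Om, slobIntegrand s v p)

/-- The dual norm `‖u‖_{H^{-s}(Ω)}` of a square integrable function `u`, for `s ∈ (0, 1/2)`. -/
def HsDualNorm {𝕜 : Type*} [RCLike 𝕜] (s : ℝ) (u : ℝ → 𝕜) : ℝ :=
  sSup {r : ℝ | ∃ v : ℝ → 𝕜, MemHs s v ∧ 0 < HsNorm s v ∧ r = ‖l2inner u v‖ / HsNorm s v}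

/-! ### Abel's integral operator and its sesquilinear form -/

/-- `A_{K,α} f (x) = Γ(α)⁻¹ ∫₀ˣ (x - y)^(α - 1) K(x, y) f(y) dy`. -/
def abelOp {𝕜 : Type*} [RCLike 𝕜] (K : ℝ → ℝ → ℝ) (α : ℝ) (f : ℝ → 𝕜) (x : ℝ) : 𝕜 :=
  (Real.Gamma α)⁻¹ • ∫ y in Ioo 0 x, ((x - y) ^ (α - 1) * K x y) • f y

/-- `a_{K,α}(u, v) = (A_{K,α} u, v)`. -/
def abelForm {𝕜 : Type*} [RCLike 𝕜] (K : ℝ → ℝ → ℝ) (α : ℝ) (u v : ℝ → 𝕜) : 𝕜 :=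
  l2inner (abelOp K α u) v

/-! ### Meshes and piecewise polynomials -/

/-- A mesh `0 = x₀ < x₁ < ⋯ < x_N = 1`; the values `x i` with `i > N` are irrelevant. -/
structure Mesh where
  N : ℕ
  x : ℕ → ℝ
  x_zero : x 0 = 0
  x_last : x N = 1
  x_lt : ∀ i < N, x i < x (i + 1)

namespace Mesh

variable (T : Mesh)

/-- The elements `τ` of the mesh, numbered from `0` to `N - 1`. -/
def elem (τ : Fin T.N) : Set ℝ := Icc (T.x τ) (T.x (τ + 1))

/-- The length `h_τ`. -/
def len (τ : Fin T.N) : ℝ := T.x (τ + 1) - T.x τ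

/-- The maximal mesh width `h`. -/
def h : ℝ := ⨆ τ : Fin T.N, T.len τ

/-- The quasi-uniformity constant `C_qu = max h / h_τ`. -/
def Cqu : ℝ := ⨆ τ : Fin T.N, T.h / T.len τ

/-- `C_𝒯 = max {h_τ / h_σ : τ ∩ σ ≠ ∅}`. -/
def CT : ℝ :=
  ⨆ p : {p : Fin T.N × Fin T.N // (T.elem p.1 ∩ T.elem p.2).Nonempty},
    T.len p.1.1 / T.len p.1.2

/-- Representatives of the functions in `S^m_𝒯`: polynomials of degree at most `m` on each
element, continuous on `[0, 1]` if `m ≥ 1`. (Values at the mesh points for `m = 0`, and values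
outside `[0, 1]`, are irrelevant.) -/
def feSpace (𝕜 : Type*) [RCLike 𝕜] (m : ℕ) : Set (ℝ → 𝕜) :=
  {v | (∀ τ : Fin T.N, ∃ p : 𝕜[X], p.natDegree ≤ m ∧
          ∀ x ∈ Ioo (T.x τ) (T.x (τ + 1)), v x = p.eval (x : 𝕜)) ∧
       (1 ≤ m → ContinuousOn v (Icc 0 1))}

/-- The dimension `M` of `S^m_𝒯`. -/
def dim (m : ℕ) : ℕ := if m = 0 then T.N else T.N * m + 1

/-- The nodal points, numbered from left to right by `0, …, M - 1`: the midpoints of the elements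
if `m = 0`, and for `m ≥ 1` the point with number `i m + j`, `0 ≤ j < m`, is
`x_i + j (x_{i+1} - x_i) / m` (so that the one with number `N m` is `x_N = 1`). -/
def node (m k : ℕ) : ℝ :=
  if m = 0 then (T.x k + T.x (k + 1)) / 2
  else T.x (k / m) + ((k % m : ℕ) : ℝ) * ((T.x (k / m + 1) - T.x (k / m)) / m)

/-- The numbers of the nodal points that lie in the `i`-th element. -/
def localDofs (m i : ℕ) : Finset ℕ := if m = 0 then {i} else Finset.Icc (i * m) (i * m + m)

/-- The polynomial which the `k`-th Lagrange basis function is on the `i`-th element. -/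
def shape (m i k : ℕ) : ℝ[X] :=
  if k ∈ localDofs m i then Lagrange.basis (localDofs m i) (T.node m) k else 0

/-- The elements made disjoint: `[x₀, x₁]`, `(x₁, x₂]`, …, `(x_{N-1}, x_N]`. -/
def cell (τ : Fin T.N) : Set ℝ :=
  if (τ : ℕ) = 0 then Icc (T.x τ) (T.x (τ + 1)) else Ioc (T.x τ) (T.x (τ + 1))

/-- The Lagrange basis `b_k` of `S^m_𝒯`, extended by zero outside `[0, 1]`. -/
def basisFun (m : ℕ) (k : Fin (T.dim m)) (x : ℝ) : ℝ :=
  ∑ τ : Fin T.N, (T.cell τ).indicator (fun t => (T.shape m τ k).eval t) x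

/-- The index set `𝓘_τ = {i : τ ⊂ supp b_i}`. -/
def idx (m : ℕ) (τ : Fin T.N) : Set (Fin (T.dim m)) :=
  {i | T.elem τ ⊆ tsupport (T.basisFun m i)}

/-! ### Local quadrature and the perturbed form -/

/-- The type of families `(Q^{i,j}_{τ×σ})` of approximations to the local integrals
`(I^{i,j}_{τ×σ})`; arguments in the order `τ σ i j`. -/
abbrev LocalQuad (m : ℕ) : Type :=
  Fin T.N → Fin T.N → Fin (T.dim m) → Fin (T.dim m) → ℝ

/-- `I^{i,j}_{τ×σ} = ∫_τ ∫_{σ ∩ [0,x]} b_i(x) b_j(y) K(x,y) (x-y)^(α-1) dy dx`. -/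
def localInt (K : ℝ → ℝ → ℝ) (α : ℝ) (m : ℕ) : T.LocalQuad m := fun τ σ i j =>
  ∫ x in T.elem τ, ∫ y in T.elem σ ∩ Icc 0 x,
    T.basisFun m i x * T.basisFun m j y * K x y * (x - y) ^ (α - 1)

open Classical in
/-- The perturbed matrix entry
`ã_{i,j} = Γ(α)⁻¹ ∑_{τ ⊂ supp b_i} ∑_{σ ⊂ supp b_j} Q^{i,j}_{τ×σ}`. -/
def pertEntry (α : ℝ) (m : ℕ) (Q : T.LocalQuad m) (i j : Fin (T.dim m)) : ℝ :=
  (Real.Gamma α)⁻¹ *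
    ∑ τ : Fin T.N with i ∈ T.idx m τ, ∑ σ : Fin T.N with j ∈ T.idx m σ, Q τ σ i j

/-- The perturbed form `ã_{K,α}(u, v) = ∑_{i,j} β̄_i ã_{i,j} α_j` for `u = ∑ α_i b_i` and
`v = ∑ β_i b_i`; the coefficients in the Lagrange basis are the nodal values. -/
def pertForm {𝕜 : Type*} [RCLike 𝕜] (α : ℝ) (m : ℕ) (Q : T.LocalQuad m) (u v : ℝ → 𝕜) : 𝕜 :=
  ∑ i : Fin (T.dim m), ∑ j : Fin (T.dim m),
    (starRingEnd 𝕜) (v (T.node m i)) * (T.pertEntry α m Q i j : 𝕜) * u (T.node m j)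

/-- The local error `E^max_{τ×σ} = max {|I^{i,j}_{τ×σ} - Q^{i,j}_{τ×σ}| : (i,j) ∈ 𝓘_τ × 𝓘_σ}`. -/
def localErrMax (K : ℝ → ℝ → ℝ) (α : ℝ) (m : ℕ) (Q : T.LocalQuad m) (τ σ : Fin T.N) : ℝ :=
  ⨆ p : T.idx m τ × T.idx m σ, |T.localInt K α m τ σ p.1 p.2 - Q τ σ p.1 p.2|

/-- The maximal local error `max_{τ,σ ∈ 𝒯} E^max_{τ×σ}`. -/
def errMax (K : ℝ → ℝ → ℝ) (α : ℝ) (m : ℕ) (Q : T.LocalQuad m) : ℝ :=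
  ⨆ p : Fin T.N × Fin T.N, T.localErrMax K α m Q p.1 p.2

end Mesh

end AbelFEM

end

/-! The proof has two halves, both resting on scaling for polynomials of degree at most `m`. On the
reference interval the `L²` norm dominates the coefficients, because all norms on a
finite-dimensional space are equivalent. An affine map then gives `‖p(x)‖² ≤ (C/h_τ) ∫_τ |p|²` and a
Lipschitz bound with `C/h_τ³` (`exists_polynomialBounds`).

Inverse inequality. A finite element function `u` is tested against itself: `‖u‖² = (u, u) ≤
‖u‖_{H^{-s}} ‖u‖_{H^s}`. It remains to show `‖u‖_{H^s} ≤ c h^{-s} ‖u‖`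
(`lintegral_slobIntegrand_le`). The double integral of the seminorm is split over pairs of elements.
On `τ × τ` the Lipschitz bound cancels the singularity. For `τ ≠ σ` the difference is bounded by the
two suprema, so jumps are allowed. This is affordable because for `s < 1/2` the kernel
`|x-y|^{-1-2s}` is integrable over `τ` times its complement, with integral of order `h_τ^{1-2s}`.
Both contributions scale like `h_τ^{-2s} ∫_τ |u|²`.

Consistency. By Fubini and the nodal expansion, the exact matrix entries are sums of the local
integrals, in which only elements inside the supports contribute (`abelForm_eq_sum`,
`localInt_eq_zero`). Since `Γ(α) ≥ 1`, an entry of the error matrix is at most the maximal local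
error times `n_i n_j`, where `n_i` counts the elements in `supp b_i`. The error is therefore
controlled by a product of two weighted `ℓ¹` norms of nodal values. The sup bound and the
Cauchy–Schwarz inequality bound each by a multiple of `(C_qu/h) ‖u‖` (`sum_norm_node_le`), since `∑
1/h_τ ≤ (C_qu/h)²`. Two applications of the inverse inequality at `s = α/2` turn `h^{-2}` into
`h^{-2-α}`. -/

namespace AbelFEM

/-! ### Mesh geometry and splitting of integrals over elements -/

namespace Mesh

variable (T : Mesh)

lemma N_pos : 0 < T.N := by
  rcases Nat.eq_zero_or_pos T.N with h | h
  · have h1 := T.x_last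
    rw [h, T.x_zero] at h1
    norm_num at h1
  · exact h

instance : Nonempty (Fin T.N) := ⟨⟨0, T.N_pos⟩⟩

lemma x_le {i j : ℕ} (hij : i ≤ j) (hj : j ≤ T.N) : T.x i ≤ T.x j := by
  induction j, hij using Nat.le_induction with
  | base => exact le_rfl
  | succ k _ ih => exact (ih (by omega)).trans (T.x_lt k (by omega)).le

lemma len_pos (τ : Fin T.N) : 0 < T.len τ := sub_pos.2 (T.x_lt τ τ.2)

lemma x_nonneg {i : ℕ} (hi : i ≤ T.N) : 0 ≤ T.x i := T.x_zero ▸ T.x_le (Nat.zero_le i) hi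

lemma x_le_one {i : ℕ} (hi : i ≤ T.N) : T.x i ≤ 1 := T.x_last ▸ T.x_le hi le_rfl

lemma len_le_h (τ : Fin T.N) : T.len τ ≤ T.h :=
  le_ciSup (f := T.len) (Set.finite_range _).bddAbove τ

lemma h_pos : 0 < T.h := (T.len_pos ⟨0, T.N_pos⟩).trans_le (T.len_le_h _)

lemma h_le_one : T.h ≤ 1 := by
  refine ciSup_le fun τ => ?_
  have h1 := T.x_nonneg τ.2.le
  have h2 := T.x_le_one (i := τ + 1) τ.2
  unfold len
  linarith

lemma h_le_Cqu_mul_len (τ : Fin T.N) : T.h ≤ T.Cqu * T.len τ := by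
  have h1 : T.h / T.len τ ≤ T.Cqu :=
    le_ciSup (f := fun τ => T.h / T.len τ) (Set.finite_range _).bddAbove τ
  rwa [div_le_iff₀ (T.len_pos τ)] at h1

lemma one_le_Cqu : 1 ≤ T.Cqu := by
  have τ : Fin T.N := ⟨0, T.N_pos⟩
  have h1 := T.h_le_Cqu_mul_len τ
  have h2 := T.len_le_h τ
  have h3 := T.len_pos τ
  by_contra! h
  nlinarith

lemma sum_len : ∑ τ : Fin T.N, T.len τ = 1 := by
  have h1 := Finset.sum_range_sub T.x T.N
  rw [T.x_last, T.x_zero, sub_zero] at h1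
  rw [← h1, Finset.sum_range]
  rfl

lemma inv_len_le (τ : Fin T.N) : (T.len τ)⁻¹ ≤ T.Cqu / T.h := by
  rw [le_div_iff₀ T.h_pos, inv_mul_le_iff₀ (T.len_pos τ), mul_comm]
  exact T.h_le_Cqu_mul_len τ

/-- The lengths add up to 1 and each is at least `h / C_qu`. -/
lemma N_le : (T.N : ℝ) ≤ T.Cqu / T.h := by
  rw [le_div_iff₀ T.h_pos]
  calc (T.N : ℝ) * T.h = ∑ _τ : Fin T.N, T.h := by simp
    _ ≤ ∑ τ : Fin T.N, T.Cqu * T.len τ := Finset.sum_le_sum fun τ _ => T.h_le_Cqu_mul_len τ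
    _ = T.Cqu := by rw [← Finset.mul_sum, T.sum_len, mul_one]

lemma sum_inv_len_le : ∑ τ : Fin T.N, (T.len τ)⁻¹ ≤ (T.Cqu / T.h) ^ 2 := by
  have h0 : 0 ≤ T.Cqu / T.h := div_nonneg (by linarith [T.one_le_Cqu]) T.h_pos.le
  calc ∑ τ : Fin T.N, (T.len τ)⁻¹ ≤ ∑ _τ : Fin T.N, T.Cqu / T.h :=
        Finset.sum_le_sum fun τ _ => T.inv_len_le τ
    _ = T.N * (T.Cqu / T.h) := by simp
    _ ≤ (T.Cqu / T.h) ^ 2 := by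
        rw [pow_two]
        exact mul_le_mul_of_nonneg_right T.N_le h0

/-- The open element `(x_i, x_{i+1})`. -/
def piece (τ : Fin T.N) : Set ℝ := Ioo (T.x τ) (T.x (τ + 1))

lemma measurableSet_piece (τ : Fin T.N) : MeasurableSet (T.piece τ) := measurableSet_Ioo

lemma piece_subset_Om (τ : Fin T.N) : T.piece τ ⊆ Om :=
  Ioo_subset_Ioo (T.x_nonneg τ.2.le) (T.x_le_one τ.2)

lemma volume_piece (τ : Fin T.N) : volume (T.piece τ) = ENNReal.ofReal (T.len τ) :=
  Real.volume_Ioo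

lemma lt_piece_of_lt {τ σ : Fin T.N} (h : τ < σ) {x y : ℝ} (hx : x ∈ T.piece τ)
    (hy : y ∈ T.piece σ) : x < T.x (τ + 1) ∧ T.x (τ + 1) < y :=
  ⟨hx.2, (T.x_le (Nat.succ_le_of_lt h) σ.2.le).trans_lt hy.1⟩

lemma pairwise_disjoint_piece : Pairwise (Function.onFun Disjoint T.piece) := by
  intro τ σ hne
  refine Set.disjoint_left.2 fun x hx hy => ?_
  rcases lt_or_gt_of_ne hne with h | h
  · have := T.lt_piece_of_lt h hx hy
    linarith [this.1, this.2]
  · have := T.lt_piece_of_lt h hy hx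
    linarith [this.1, this.2]

lemma exists_mem_piece {x : ℝ} (hx : x ∈ Om) (hne : x ∉ range fun i : Fin (T.N + 1) => T.x i) :
    ∃ τ, x ∈ T.piece τ := by
  classical
  have hex : ∃ i, x ≤ T.x i := ⟨T.N, by rw [T.x_last]; exact hx.2.le⟩
  have hi := Nat.find_spec hex
  have hmin : ∀ j < Nat.find hex, ¬ x ≤ T.x j := fun j hj => Nat.find_min hex hj
  have hle : Nat.find hex ≤ T.N := Nat.find_min' hex (by rw [T.x_last]; exact hx.2.le)
  set i := Nat.find hex
  have hi0 : i ≠ 0 := by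
    intro h0
    rw [h0, T.x_zero] at hi
    exact absurd hx.1 (not_lt.2 hi)
  obtain ⟨k, hk⟩ := Nat.exists_eq_succ_of_ne_zero hi0
  refine ⟨⟨k, by omega⟩, lt_of_not_ge (hmin k (by omega)), ?_⟩
  have h2 : T.x i ≠ x := fun h => hne ⟨⟨i, by omega⟩, h⟩
  have : x < T.x i := lt_of_le_of_ne hi h2.symm
  rwa [hk] at this

/-- Only the finitely many mesh points are lost, so every integral may be split over disjoint open
elements, where a finite element function is exactly a polynomial. -/
lemma Om_ae_eq_iUnion : (Om : Set ℝ) =ᵐ[volume] ⋃ τ, T.piece τ := by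
  have h0 : ∀ᵐ x : ℝ, x ∉ range fun i : Fin (T.N + 1) => T.x i :=
    compl_mem_ae_iff.2 ((Set.finite_range _).measure_zero _)
  filter_upwards [h0] with x hx
  refine propext ⟨fun h => ?_, fun h => ?_⟩
  · exact mem_iUnion.2 (T.exists_mem_piece h hx)
  · obtain ⟨τ, hτ⟩ := mem_iUnion.1 h
    exact T.piece_subset_Om τ hτ

lemma restrict_Om : volume.restrict Om = ∑ τ, volume.restrict (T.piece τ) := by
  rw [Measure.restrict_congr_set T.Om_ae_eq_iUnion,
    Measure.restrict_iUnion T.pairwise_disjoint_piece T.measurableSet_piece, Measure.sum_fintype]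

lemma lintegral_Om (f : ℝ → ENNReal) : ∫⁻ x in Om, f x = ∑ τ, ∫⁻ x in T.piece τ, f x := by
  rw [T.restrict_Om, lintegral_finsetSum_measure]

lemma integral_Om {E : Type*} [NormedAddCommGroup E] [NormedSpace ℝ E] {f : ℝ → E}
    (hf : IntegrableOn f Om) : ∫ x in Om, f x = ∑ τ, ∫ x in T.piece τ, f x := by
  rw [T.restrict_Om, integral_finsetSum_measure]
  intro τ _
  exact hf.mono_set (T.piece_subset_Om τ)

lemma ae_Om_exists_piece : ∀ᵐ x ∂(volume.restrict Om), ∃ τ, x ∈ T.piece τ := by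
  refine (ae_restrict_iff' (show MeasurableSet Om from measurableSet_Ioo)).2 ?_
  filter_upwards [T.Om_ae_eq_iUnion] with x hx hx'
  have : x ∈ ⋃ τ, T.piece τ := hx.mp hx'
  simpa using this

lemma elem_ae_eq_piece (τ : Fin T.N) : (T.elem τ : Set ℝ) =ᵐ[volume] T.piece τ :=
  Ioo_ae_eq_Icc.symm

end Mesh

end AbelFEM

/-! ### Norm equivalence for polynomials on an interval -/

namespace AbelFEM

section PolynomialBounds

variable {𝕜 : Type*} [RCLike 𝕜]

/-- The right side is continuous and 2-homogeneous in the coefficients. It is positive for `c ≠ 0`,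
since a polynomial vanishing on `[0, 1]` has infinitely many roots. Its minimum over the compact
unit sphere serves as `δ`. -/
lemma exists_pos_mul_norm_sq_le_integral (𝕜 : Type*) [RCLike 𝕜] (m : ℕ) :
    ∃ δ : ℝ, 0 < δ ∧ ∀ c : Fin (m + 1) → 𝕜,
      δ * ‖c‖ ^ 2 ≤ ∫ t in (0 : ℝ)..1, ‖∑ k, c k * (t : 𝕜) ^ (k : ℕ)‖ ^ 2 := by
  set F : (Fin (m + 1) → 𝕜) → ℝ := fun c =>
    ∫ t in (0 : ℝ)..1, ‖∑ k, c k * (t : 𝕜) ^ (k : ℕ)‖ ^ 2 with hF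
  have hcont2 : Continuous fun z : (Fin (m + 1) → 𝕜) × ℝ =>
      ‖∑ k, z.1 k * (z.2 : 𝕜) ^ (k : ℕ)‖ ^ 2 := by
    have : Continuous fun t : ℝ => (t : 𝕜) := RCLike.continuous_ofReal
    fun_prop
  have hcont : Continuous F :=
    intervalIntegral.continuous_parametric_intervalIntegral_of_continuous' (μ := volume)
      (f := fun (c : Fin (m + 1) → 𝕜) (t : ℝ) => ‖∑ k, c k * (t : 𝕜) ^ (k : ℕ)‖ ^ 2) hcont2 0 1
  have hpos : ∀ c, c ≠ 0 → 0 < F c := by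
    intro c hc
    obtain ⟨j, hj⟩ := Function.ne_iff.1 hc
    refine intervalIntegral.integral_pos one_pos ?_ (fun t _ => by positivity) ?_
    · exact (hcont2.comp (by fun_prop : Continuous fun t : ℝ => (c, t))).continuousOn
    · by_contra! h
      set P : 𝕜[X] := ∑ k : Fin (m + 1), Polynomial.C (c k) * X ^ (k : ℕ) with hP
      have hroot : ∀ t ∈ Icc (0 : ℝ) 1, P.IsRoot (t : 𝕜) := by
        intro t ht
        have h1 := h t ht
        have h2 : ‖∑ k, c k * (t : 𝕜) ^ (k : ℕ)‖ = 0 :=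
          pow_eq_zero_iff (two_ne_zero) |>.1 (le_antisymm h1 (by positivity))
        rw [norm_eq_zero] at h2
        simpa [Polynomial.IsRoot, hP, Polynomial.eval_finsetSum] using h2
      have hinf : Set.Infinite {x | P.IsRoot x} := by
        refine Set.Infinite.mono ?_
          ((Icc_infinite (zero_lt_one (α := ℝ))).image (RCLike.ofReal_injective (K := 𝕜)).injOn)
        rintro _ ⟨t, ht, rfl⟩
        exact hroot t ht
      have hP0 := Polynomial.eq_zero_of_infinite_isRoot P hinf
      have := congrArg (fun p => Polynomial.coeff p (j : ℕ)) hP0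
      simp only [hP, Polynomial.finsetSum_coeff, Polynomial.coeff_C_mul, Polynomial.coeff_X_pow,
        Polynomial.coeff_zero] at this
      rw [Finset.sum_eq_single j] at this
      · exact hj (by simpa using this)
      · intro b _ hb
        simp [Fin.val_ne_of_ne hb.symm]
      · simp
  obtain ⟨c₀, hc₀, hmin⟩ := (isCompact_sphere (0 : Fin (m + 1) → 𝕜) 1).exists_isMinOn
    ⟨fun _ => 1, by simp⟩ hcont.continuousOn
  refine ⟨F c₀, hpos c₀ ?_, fun c => ?_⟩
  · rintro rfl
    simp at hc₀
  · rcases eq_or_ne c 0 with rfl | hc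
    · simp
    · have hn : 0 < ‖c‖ := norm_pos_iff.2 hc
      have h1 : F c₀ ≤ F (((‖c‖⁻¹ : ℝ) : 𝕜) • c) := by
        refine hmin ?_
        simp [norm_smul, hn.ne']
      have h2 : F (((‖c‖⁻¹ : ℝ) : 𝕜) • c) = ‖c‖⁻¹ ^ 2 * F c := by
        rw [hF]
        simp only
        rw [← intervalIntegral.integral_const_mul]
        congr 1
        funext t
        rw [← mul_pow]
        congr 1
        simp only [Pi.smul_apply, smul_eq_mul, mul_assoc]
        rw [← Finset.mul_sum, norm_mul]
        simp
      rw [h2, inv_pow, inv_mul_eq_div, le_div_iff₀ (by positivity)] at h1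
      exact h1

/-- The supremum and Lipschitz bounds with constant `C` in terms of the `L²` norm, for polynomials
of degree at most `m` on an arbitrary interval. -/
def PolynomialBounds (𝕜 : Type*) [RCLike 𝕜] (m : ℕ) (C : ℝ) : Prop :=
  ∀ p : 𝕜[X], p.natDegree ≤ m → ∀ a b : ℝ, a < b → ∀ x ∈ Icc a b, ∀ y ∈ Icc a b,
      ‖p.eval (x : 𝕜)‖ ^ 2 ≤ C / (b - a) * ∫ t in Ioo a b, ‖p.eval (t : 𝕜)‖ ^ 2 ∧
      ‖p.eval (x : 𝕜) - p.eval (y : 𝕜)‖ ^ 2 ≤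
        C / (b - a) ^ 3 * |x - y| ^ 2 * ∫ t in Ioo a b, ‖p.eval (t : 𝕜)‖ ^ 2

/-- Pulling back to `[0, 1]` reduces both bounds to the size of the coefficients; the powers of `b -
a` come from the change of variables. -/
lemma exists_polynomialBounds (𝕜 : Type*) [RCLike 𝕜] (m : ℕ) :
    ∃ C : ℝ, 0 < C ∧ PolynomialBounds 𝕜 m C := by
  obtain ⟨δ, hδ, hδc⟩ := exists_pos_mul_norm_sq_le_integral 𝕜 m
  -- With `c` the coefficients on `[0, 1]`, the number `(m + 1)² ‖c‖` bounds both the supremum (`m +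
  -- 1` terms) and the Lipschitz constant (each monomial contributes at most `m + 1`). It is
  -- squared, and `‖c‖²` costs a factor `1/δ`.
  refine ⟨((m + 1 : ℝ) ^ 2) ^ 2 / δ, by positivity, fun p hp a b hab x hx y hy => ?_⟩
  have hl : 0 < b - a := sub_pos.2 hab
  set q : 𝕜[X] := p.comp (Polynomial.C (a : 𝕜) + Polynomial.C ((b - a : ℝ) : 𝕜) * X) with hq
  have hqdeg : q.natDegree < m + 1 := by
    have h1 : (Polynomial.C (a : 𝕜) + Polynomial.C ((b - a : ℝ) : 𝕜) * X).natDegree ≤ 1 := by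
      compute_degree
    have h2 := Polynomial.natDegree_comp (p := p)
      (q := Polynomial.C (a : 𝕜) + Polynomial.C ((b - a : ℝ) : 𝕜) * X)
    have : q.natDegree ≤ m * 1 := h2 ▸ Nat.mul_le_mul hp h1
    omega
  set c : Fin (m + 1) → 𝕜 := fun k => q.coeff k with hc
  have hqeval : ∀ t : ℝ, p.eval ((a + (b - a) * t : ℝ) : 𝕜) = ∑ k, c k * (t : 𝕜) ^ (k : ℕ) := by
    intro t
    have h1 : q.eval (t : 𝕜) = p.eval ((a + (b - a) * t : ℝ) : 𝕜) := by
      simp [hq, Polynomial.eval_comp]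
    rw [← h1, Polynomial.eval_eq_sum_range' hqdeg, Finset.sum_range]
  have hI : ∫ t in Ioo a b, ‖p.eval (t : 𝕜)‖ ^ 2 =
      (b - a) * ∫ t in (0 : ℝ)..1, ‖∑ k, c k * (t : 𝕜) ^ (k : ℕ)‖ ^ 2 := by
    have h1 := intervalIntegral.smul_integral_comp_add_mul (a := 0) (b := 1)
      (fun t : ℝ => ‖p.eval (t : 𝕜)‖ ^ 2) (b - a) a
    simp only [hqeval, mul_zero, add_zero, mul_one, add_sub_cancel, smul_eq_mul] at h1
    rw [h1, intervalIntegral.integral_of_le hab.le, integral_Ioc_eq_integral_Ioo]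
  have hcI : ‖c‖ ^ 2 ≤ 1 / δ * ((b - a)⁻¹ * ∫ t in Ioo a b, ‖p.eval (t : 𝕜)‖ ^ 2) := by
    rw [hI, inv_mul_cancel_left₀ hl.ne', one_div, le_inv_mul_iff₀ hδ]
    exact hδc c
  have hpt : ∀ z ∈ Icc a b, ∃ t ∈ Icc (0 : ℝ) 1, z = a + (b - a) * t := by
    intro z hz
    refine ⟨(z - a) / (b - a), ⟨div_nonneg (by linarith [hz.1]) hl.le, ?_⟩, ?_⟩
    · rw [div_le_one hl]
      linarith [hz.2]
    · field_simp
      ring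
  obtain ⟨t, ht, rfl⟩ := hpt x hx
  obtain ⟨r, hr, rfl⟩ := hpt y hy
  set I := ∫ t in Ioo a b, ‖p.eval (t : 𝕜)‖ ^ 2
  have hk : ∀ k : Fin (m + 1), ‖c k‖ ≤ ‖c‖ := norm_le_pi_norm c
  have hone : (1 : ℝ) ≤ m + 1 := by
    have : (0 : ℝ) ≤ m := Nat.cast_nonneg m
    linarith
  have hsup : ‖p.eval ((a + (b - a) * t : ℝ) : 𝕜)‖ ≤ (m + 1) ^ 2 * ‖c‖ := by
    rw [hqeval]
    calc ‖∑ k, c k * (t : 𝕜) ^ (k : ℕ)‖ ≤ ∑ _k : Fin (m + 1), ‖c‖ := by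
          refine norm_sum_le_of_le _ fun k _ => ?_
          rw [norm_mul, norm_pow, RCLike.norm_ofReal, abs_of_nonneg ht.1]
          calc _ ≤ ‖c‖ * 1 := mul_le_mul (hk k) (pow_le_one₀ ht.1 ht.2)
                (pow_nonneg ht.1 _) (norm_nonneg _)
            _ = _ := mul_one _
      _ = (m + 1) * ‖c‖ := by simp
      _ ≤ (m + 1) ^ 2 * ‖c‖ := by
          gcongr
          nlinarith
  have hlip : ‖p.eval ((a + (b - a) * t : ℝ) : 𝕜) - p.eval ((a + (b - a) * r : ℝ) : 𝕜)‖ ≤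
      (m + 1) ^ 2 * ‖c‖ * |t - r| := by
    rw [hqeval, hqeval, ← Finset.sum_sub_distrib]
    calc ‖∑ k : Fin (m + 1), (c k * (t : 𝕜) ^ (k : ℕ) - c k * (r : 𝕜) ^ (k : ℕ))‖
        ≤ ∑ _k : Fin (m + 1), ‖c‖ * (|t - r| * (m + 1)) := by
          refine norm_sum_le_of_le _ fun k _ => ?_
          rw [← mul_sub, norm_mul]
          refine mul_le_mul (hk k) ?_ (norm_nonneg _) (norm_nonneg _)
          have h1 : (t : 𝕜) ^ (k : ℕ) - (r : 𝕜) ^ (k : ℕ) =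
              ((t ^ (k : ℕ) - r ^ (k : ℕ) : ℝ) : 𝕜) := by push_cast; rfl
          rw [h1, RCLike.norm_ofReal]
          refine (abs_pow_sub_pow_le t r k).trans ?_
          have h2 : max |t| |r| ≤ 1 := by
            rw [abs_of_nonneg ht.1, abs_of_nonneg hr.1]
            exact max_le ht.2 hr.2
          have h3 : max |t| |r| ^ ((k : ℕ) - 1) ≤ 1 :=
            pow_le_one₀ (le_max_of_le_left (abs_nonneg _)) h2
          have h4 : ((k : ℕ) : ℝ) ≤ m + 1 := by
            exact_mod_cast k.2.le
          calc |t - r| * (k : ℕ) * max |t| |r| ^ ((k : ℕ) - 1) ≤ |t - r| * (k : ℕ) * 1 := by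
                gcongr
            _ ≤ |t - r| * (m + 1) := by
                rw [mul_one]
                gcongr
      _ = (m + 1) ^ 2 * ‖c‖ * |t - r| := by
          simp
          ring
  constructor
  · calc ‖p.eval ((a + (b - a) * t : ℝ) : 𝕜)‖ ^ 2 ≤ ((m + 1) ^ 2 * ‖c‖) ^ 2 := by gcongr
      _ = ((m + 1 : ℝ) ^ 2) ^ 2 * ‖c‖ ^ 2 := by ring
      _ ≤ ((m + 1 : ℝ) ^ 2) ^ 2 * (1 / δ * ((b - a)⁻¹ * I)) := by gcongr
      _ = ((m + 1 : ℝ) ^ 2) ^ 2 / δ / (b - a) * I := by ring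
  · have hd : a + (b - a) * t - (a + (b - a) * r) = (b - a) * (t - r) := by ring
    rw [hd, abs_mul, abs_of_pos hl]
    calc _ ≤ ((m + 1) ^ 2 * ‖c‖ * |t - r|) ^ 2 := by gcongr
      _ = ((m + 1 : ℝ) ^ 2) ^ 2 * |t - r| ^ 2 * ‖c‖ ^ 2 := by ring
      _ ≤ ((m + 1 : ℝ) ^ 2) ^ 2 * |t - r| ^ 2 * (1 / δ * ((b - a)⁻¹ * I)) := by gcongr
      _ = _ := by
        field_simp

end PolynomialBounds

end AbelFEM

/-! ### Integrals of the singular kernel -/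

namespace AbelFEM

section SingularKernel

lemma lintegral_Ioi_rpow {s c : ℝ} (hs : 0 < s) (hc : 0 < c) :
    ∫⁻ t in Ioi c, ENNReal.ofReal (|t| ^ (-(1 + 2 * s))) =
      ENNReal.ofReal (c ^ (-(2 * s)) / (2 * s)) := by
  have h1 : -(1 + 2 * s) < -1 := by linarith
  have h2 : ∫⁻ t in Ioi c, ENNReal.ofReal (|t| ^ (-(1 + 2 * s))) =
      ∫⁻ t in Ioi c, ENNReal.ofReal (t ^ (-(1 + 2 * s))) := by
    refine setLIntegral_congr_fun measurableSet_Ioi fun t ht => ?_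
    simp only [abs_of_pos (hc.trans ht)]
  rw [h2, ← ofReal_integral_eq_lintegral_ofReal (integrableOn_Ioi_rpow_of_lt h1 hc),
    integral_Ioi_rpow_of_lt h1 hc]
  · congr 1
    rw [show -(1 + 2 * s) + 1 = -(2 * s) by ring, neg_div_neg_eq]
  · filter_upwards [self_mem_ae_restrict measurableSet_Ioi] with t ht
    exact Real.rpow_nonneg (hc.trans ht).le _

/-- Integrating the kernel over a half line leaves the power `-2s` of the distance to the end point;
this remains integrable up to that end point exactly because `s < 1/2`. -/
lemma lintegral_Ioo_rpow {s l : ℝ} (hs : s < 1 / 2) (hl : 0 < l) :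
    ∫⁻ t in Ioo 0 l, ENNReal.ofReal (t ^ (-(2 * s))) =
      ENNReal.ofReal (l ^ (1 - 2 * s) / (1 - 2 * s)) := by
  have h1 : -1 < -(2 * s) := by linarith
  have h2 : IntegrableOn (fun t : ℝ => t ^ (-(2 * s))) (Ioo 0 l) := by
    have := (intervalIntegral.intervalIntegrable_rpow' (a := 0) (b := l) h1)
    rw [intervalIntegrable_iff_integrableOn_Ioo_of_le hl.le] at this
    exact this
  rw [← ofReal_integral_eq_lintegral_ofReal h2, ← integral_Ioc_eq_integral_Ioo,
    ← intervalIntegral.integral_of_le hl.le, integral_rpow (Or.inl h1)]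
  · congr 1
    rw [show -(2 * s) + 1 = 1 - 2 * s by ring, Real.zero_rpow (by linarith), sub_zero]
  · filter_upwards [self_mem_ae_restrict measurableSet_Ioo] with t ht
    exact Real.rpow_nonneg ht.1.le _

/-- The kernel `|x - y|^(-1-2s)`. -/
noncomputable def singKernel (s x y : ℝ) : ENNReal := ENNReal.ofReal (|x - y| ^ (-(1 + 2 * s)))

lemma singKernel_comm (s x y : ℝ) : singKernel s x y = singKernel s y x := by
  rw [singKernel, singKernel, abs_sub_comm]

lemma measurable_singKernel (s : ℝ) : Measurable fun p : ℝ × ℝ => singKernel s p.1 p.2 := by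
  unfold singKernel
  fun_prop

lemma lintegral_singKernel_Ioi {s x b : ℝ} (hs : 0 < s) (hx : x < b) :
    ∫⁻ y in Ioi b, singKernel s x y = ENNReal.ofReal ((b - x) ^ (-(2 * s)) / (2 * s)) := by
  have h := (measurePreserving_sub_right volume x).setLIntegral_comp_preimage
    (measurableSet_Ioi (a := b - x))
    (by fun_prop : Measurable fun t : ℝ => ENNReal.ofReal (|t| ^ (-(1 + 2 * s))))
  rw [lintegral_Ioi_rpow hs (sub_pos.2 hx)] at h
  rw [← h]
  simp [singKernel, abs_sub_comm x]

lemma lintegral_singKernel_Iio {s x a : ℝ} (hs : 0 < s) (hx : a < x) :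
    ∫⁻ y in Iio a, singKernel s x y = ENNReal.ofReal ((x - a) ^ (-(2 * s)) / (2 * s)) := by
  have h := (volume.measurePreserving_sub_left x).setLIntegral_comp_preimage
    (measurableSet_Ioi (a := x - a))
    (by fun_prop : Measurable fun t : ℝ => ENNReal.ofReal (|t| ^ (-(1 + 2 * s))))
  rw [lintegral_Ioi_rpow hs (sub_pos.2 hx)] at h
  rw [← h]
  simp [singKernel]

lemma lintegral_Ioo_sub_left_rpow {s a b : ℝ} (hs : s < 1 / 2) (hab : a < b) :
    ∫⁻ x in Ioo a b, ENNReal.ofReal ((x - a) ^ (-(2 * s))) =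
      ENNReal.ofReal ((b - a) ^ (1 - 2 * s) / (1 - 2 * s)) := by
  have h := (measurePreserving_sub_right volume a).setLIntegral_comp_preimage
    (measurableSet_Ioo (a := 0) (b := b - a))
    (by fun_prop : Measurable fun t : ℝ => ENNReal.ofReal (t ^ (-(2 * s))))
  rw [lintegral_Ioo_rpow hs (sub_pos.2 hab)] at h
  rw [← h]
  simp

lemma lintegral_Ioo_sub_right_rpow {s a b : ℝ} (hs : s < 1 / 2) (hab : a < b) :
    ∫⁻ x in Ioo a b, ENNReal.ofReal ((b - x) ^ (-(2 * s))) =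
      ENNReal.ofReal ((b - a) ^ (1 - 2 * s) / (1 - 2 * s)) := by
  have h := (volume.measurePreserving_sub_left b).setLIntegral_comp_preimage
    (measurableSet_Ioo (a := 0) (b := b - a))
    (by fun_prop : Measurable fun t : ℝ => ENNReal.ofReal (t ^ (-(2 * s))))
  rw [lintegral_Ioo_rpow hs (sub_pos.2 hab)] at h
  rw [← h]
  simp

/-- The interaction of an interval with its complement. -/
lemma lintegral_singKernel_compl_le {s a b : ℝ} (hs0 : 0 < s) (hs : s < 1 / 2) (hab : a < b) :
    ∫⁻ x in Ioo a b, ∫⁻ y in Iio a ∪ Ioi b, singKernel s x y ≤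
      ENNReal.ofReal ((b - a) ^ (1 - 2 * s) / (s * (1 - 2 * s))) := by
  calc ∫⁻ x in Ioo a b, ∫⁻ y in Iio a ∪ Ioi b, singKernel s x y
      ≤ ∫⁻ x in Ioo a b, (ENNReal.ofReal (1 / (2 * s)) * ENNReal.ofReal ((x - a) ^ (-(2 * s))) +
          ENNReal.ofReal (1 / (2 * s)) * ENNReal.ofReal ((b - x) ^ (-(2 * s)))) := by
        refine setLIntegral_mono' measurableSet_Ioo fun x hx => ?_
        refine (lintegral_union_le _ _ _).trans ?_
        rw [lintegral_singKernel_Iio hs0 hx.1, lintegral_singKernel_Ioi hs0 hx.2,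
          ← ENNReal.ofReal_mul (by positivity), ← ENNReal.ofReal_mul (by positivity),
          one_div_mul_eq_div, one_div_mul_eq_div]
    _ = ENNReal.ofReal (1 / (2 * s)) * ENNReal.ofReal ((b - a) ^ (1 - 2 * s) / (1 - 2 * s)) +
        ENNReal.ofReal (1 / (2 * s)) * ENNReal.ofReal ((b - a) ^ (1 - 2 * s) / (1 - 2 * s)) := by
        rw [lintegral_add_left (by fun_prop), lintegral_const_mul _ (by fun_prop),
          lintegral_const_mul _ (by fun_prop), lintegral_Ioo_sub_left_rpow hs hab,
          lintegral_Ioo_sub_right_rpow hs hab]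
    _ ≤ _ := by
        have h1 : 0 < 1 - 2 * s := by linarith
        have h2 : 0 ≤ (b - a) ^ (1 - 2 * s) := Real.rpow_nonneg (by linarith) _
        rw [← ENNReal.ofReal_mul (by positivity), ← ENNReal.ofReal_add (by positivity)
          (by positivity)]
        refine ENNReal.ofReal_le_ofReal (le_of_eq ?_)
        field_simp
        ring

end SingularKernel

/-! ### Inverse estimate for the Slobodeckij seminorm -/

section Seminorm

variable {𝕜 : Type*} [RCLike 𝕜]

lemma measurable_slobIntegrand (s : ℝ) {U : ℝ → 𝕜} (hU : Measurable U) :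
    Measurable (slobIntegrand s U) := by
  unfold slobIntegrand
  fun_prop

lemma slobIntegrand_nonneg (s : ℝ) (U : ℝ → 𝕜) (p : ℝ × ℝ) : 0 ≤ slobIntegrand s U p := by
  unfold slobIntegrand
  positivity

/-- Used for points in different elements, where no smallness of `U x - U y` is available: `|a - b|²
≤ 2|a|² + 2|b|²`. -/
lemma slobIntegrand_le_mul_singKernel {s : ℝ} {U : ℝ → 𝕜} {x y A B : ℝ}
    (hx : ‖U x‖ ^ 2 ≤ A) (hy : ‖U y‖ ^ 2 ≤ B) :
    ENNReal.ofReal (slobIntegrand s U (x, y)) ≤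
      ENNReal.ofReal (2 * A + 2 * B) * singKernel s x y := by
  have hA : 0 ≤ A := (sq_nonneg _).trans hx
  have hB : 0 ≤ B := (sq_nonneg _).trans hy
  rw [singKernel, ← ENNReal.ofReal_mul (by positivity)]
  refine ENNReal.ofReal_le_ofReal ?_
  rw [slobIntegrand, Real.rpow_neg (abs_nonneg _), ← div_eq_mul_inv]
  refine div_le_div_of_nonneg_right ?_ (Real.rpow_nonneg (abs_nonneg _) _)
  have h1 := norm_sub_le (U x) (U y)
  have h2 := norm_nonneg (U x - U y)
  have h3 : ‖U x - U y‖ ^ 2 ≤ (‖U x‖ + ‖U y‖) ^ 2 := by gcongr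
  nlinarith [sq_nonneg (‖U x‖ - ‖U y‖)]

/-- Used inside one element: the Lipschitz bound leaves the exponent `2 - (1 + 2s) = 1 - 2s > 0`, so
the quotient is bounded. -/
lemma slobIntegrand_le_of_lipschitz {s : ℝ} (hs : s < 1 / 2) {U : ℝ → 𝕜} {x y A l : ℝ}
    (hA : 0 ≤ A) (hl : |x - y| ≤ l) (hxy : ‖U x - U y‖ ^ 2 ≤ A * |x - y| ^ 2) :
    slobIntegrand s U (x, y) ≤ A * l ^ (1 - 2 * s) := by
  have hl0 : 0 ≤ l := (abs_nonneg _).trans hl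
  unfold slobIntegrand
  rcases (abs_nonneg (x - y)).eq_or_lt with h | h
  · simp only
    rw [← h] at hxy ⊢
    have h1 : ‖U x - U y‖ ^ 2 = 0 := le_antisymm (by simpa using hxy) (sq_nonneg _)
    rw [h1, zero_div]
    exact mul_nonneg hA (Real.rpow_nonneg hl0 _)
  · rw [div_le_iff₀ (Real.rpow_pos_of_pos h _)]
    have h2 : |x - y| ^ 2 = |x - y| ^ (1 - 2 * s) * |x - y| ^ (1 + 2 * s) := by
      rw [← Real.rpow_add h, ← Real.rpow_natCast]
      congr 1
      push_cast
      ring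
    calc ‖U x - U y‖ ^ 2 ≤ A * |x - y| ^ 2 := hxy
      _ = A * |x - y| ^ (1 - 2 * s) * |x - y| ^ (1 + 2 * s) := by rw [h2, mul_assoc]
      _ ≤ A * l ^ (1 - 2 * s) * |x - y| ^ (1 + 2 * s) := by
          have : |x - y| ^ (1 - 2 * s) ≤ l ^ (1 - 2 * s) :=
            Real.rpow_le_rpow h.le hl (by linarith)
          gcongr

namespace Mesh

variable (T : Mesh)

/-- All other elements are disjoint and lie to the left or right of `τ`. Bounding their union at
once avoids any dependence on the number of elements. -/
lemma sum_lintegral_singKernel_le {s : ℝ} (hs0 : 0 < s) (hs : s < 1 / 2) (τ : Fin T.N) :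
    ∑ σ ∈ Finset.univ.erase τ, ∫⁻ x in T.piece τ, ∫⁻ y in T.piece σ, singKernel s x y ≤
      ENNReal.ofReal (T.len τ ^ (1 - 2 * s) / (s * (1 - 2 * s))) := by
  have hm : ∀ σ, Measurable fun x => ∫⁻ y in T.piece σ, singKernel s x y := fun σ =>
    (measurable_singKernel s).lintegral_prod_right'
  rw [← lintegral_finsetSum _ fun σ _ => hm σ]
  refine le_trans (lintegral_mono fun x => ?_)
    (lintegral_singKernel_compl_le hs0 hs (T.x_lt τ τ.2))
  rw [← lintegral_biUnion_finset (T.pairwise_disjoint_piece.set_pairwise _)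
    (fun σ _ => T.measurableSet_piece σ)]
  refine lintegral_mono_set (iUnion₂_subset fun σ hσ y hy => ?_)
  have hne : σ ≠ τ := Finset.ne_of_mem_erase hσ
  rcases lt_or_gt_of_ne hne with h | h
  · exact Or.inl (hy.2.trans_le (T.x_le (Nat.succ_le_of_lt h) τ.2.le))
  · exact Or.inr ((T.x_le (Nat.succ_le_of_lt h) σ.2.le).trans_lt hy.1)

lemma lintegral_singKernel_symm (s : ℝ) (τ σ : Fin T.N) :
    ∫⁻ x in T.piece τ, ∫⁻ y in T.piece σ, singKernel s x y =
      ∫⁻ x in T.piece σ, ∫⁻ y in T.piece τ, singKernel s x y := by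
  rw [lintegral_lintegral_swap (measurable_singKernel s).aemeasurable]
  simp only [singKernel_comm s]

/-- Exchanging the summation indices over off-diagonal pairs moves the weight `S j` onto `S i`, so
that each element only meets its total interaction with the others. -/
lemma sum_sum_erase_add_mul {ι : Type*} [Fintype ι] [DecidableEq ι] (S : ι → ENNReal)
    (W : ι → ι → ENNReal) (hW : ∀ i j, W i j = W j i) :
    ∑ i, ∑ j ∈ Finset.univ.erase i, (2 * S i + 2 * S j) * W i j =
      ∑ i, 4 * S i * ∑ j ∈ Finset.univ.erase i, W i j := by
  have h1 : ∑ i, ∑ j ∈ Finset.univ.erase i, 2 * S j * W i j =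
      ∑ i, ∑ j ∈ Finset.univ.erase i, 2 * S i * W i j := by
    rw [Finset.sum_comm' (t' := Finset.univ) (s' := fun j => Finset.univ.erase j)]
    · simp only [hW]
    · simp [eq_comm]
  simp only [add_mul, Finset.sum_add_distrib]
  rw [h1, ← Finset.sum_add_distrib]
  refine Finset.sum_congr rfl fun i _ => ?_
  rw [← Finset.sum_add_distrib, Finset.mul_sum]
  refine Finset.sum_congr rfl fun j _ => ?_
  ring

lemma len_rpow_le {s : ℝ} (hs : 0 < s) (τ : Fin T.N) :
    T.len τ ^ (-(2 * s)) ≤ T.Cqu ^ (2 * s) * T.h ^ (-(2 * s)) := by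
  have hC : 0 ≤ T.Cqu := by linarith [T.one_le_Cqu]
  have h1 := Real.rpow_le_rpow (inv_nonneg.2 (T.len_pos τ).le) (T.inv_len_le τ)
    (by positivity : 0 ≤ 2 * s)
  rwa [Real.inv_rpow (T.len_pos τ).le, ← Real.rpow_neg (T.len_pos τ).le,
    Real.div_rpow hC T.h_pos.le, div_eq_mul_inv, ← Real.rpow_neg T.h_pos.le] at h1

/-- The inverse estimate for the Slobodeckij seminorm of piecewise polynomials. -/
lemma lintegral_slobIntegrand_le {s C : ℝ} (hs0 : 0 < s) (hs : s < 1 / 2) (hC : 0 < C)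
    {U : ℝ → 𝕜} (hU : Measurable U) (hint : IntegrableOn (fun x => ‖U x‖ ^ 2) Om)
    (hsup : ∀ τ, ∀ x ∈ T.piece τ,
      ‖U x‖ ^ 2 ≤ C / T.len τ * ∫ t in T.piece τ, ‖U t‖ ^ 2)
    (hlip : ∀ τ, ∀ x ∈ T.piece τ, ∀ y ∈ T.piece τ,
      ‖U x - U y‖ ^ 2 ≤ C / T.len τ ^ 3 * |x - y| ^ 2 * ∫ t in T.piece τ, ‖U t‖ ^ 2) :
    ∫⁻ p in Om ×ˢ Om, ENNReal.ofReal (slobIntegrand s U p) ≤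
      ENNReal.ofReal (C * (1 + 4 / (s * (1 - 2 * s))) * T.Cqu ^ (2 * s) * T.h ^ (-(2 * s)) *
        ∫ x in Om, ‖U x‖ ^ 2) := by
  classical
  have hs1 : 0 < 1 - 2 * s := by linarith
  set E : Fin T.N → ℝ := fun τ => ∫ t in T.piece τ, ‖U t‖ ^ 2 with hE
  have hE0 : ∀ τ, 0 ≤ E τ := fun τ => integral_nonneg fun t => sq_nonneg _
  have hl : ∀ τ, 0 < T.len τ := T.len_pos
  set f : ℝ × ℝ → ENNReal := fun p => ENNReal.ofReal (slobIntegrand s U p) with hf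
  have hfm : Measurable f := (measurable_slobIntegrand s hU).ennreal_ofReal
  set W : Fin T.N → Fin T.N → ENNReal := fun τ σ =>
    ∫⁻ x in T.piece τ, ∫⁻ y in T.piece σ, singKernel s x y with hW
  set S : Fin T.N → ENNReal := fun τ => ENNReal.ofReal (C / T.len τ * E τ) with hS
  have hsplit : ∫⁻ p in Om ×ˢ Om, f p =
      ∑ τ, ∑ σ, ∫⁻ x in T.piece τ, ∫⁻ y in T.piece σ, f (x, y) := by
    rw [Measure.volume_eq_prod, ← Measure.prod_restrict, lintegral_prod _ hfm.aemeasurable,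
      T.lintegral_Om]
    refine Finset.sum_congr rfl fun τ _ => ?_
    rw [← lintegral_finsetSum _ fun σ _ => hfm.lintegral_prod_right']
    simp only [T.lintegral_Om]
  have hdiag : ∀ τ, ∫⁻ x in T.piece τ, ∫⁻ y in T.piece τ, f (x, y) ≤
      ENNReal.ofReal (C * E τ * T.len τ ^ (-(2 * s))) := by
    intro τ
    calc ∫⁻ x in T.piece τ, ∫⁻ y in T.piece τ, f (x, y)
        ≤ ∫⁻ x in T.piece τ, ∫⁻ y in T.piece τ,
          ENNReal.ofReal (C / T.len τ ^ 3 * E τ * T.len τ ^ (1 - 2 * s)) := by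
          refine setLIntegral_mono' (T.measurableSet_piece τ) fun x hx =>
            setLIntegral_mono' (T.measurableSet_piece τ) fun y hy => ?_
          refine ENNReal.ofReal_le_ofReal (slobIntegrand_le_of_lipschitz hs ?_ ?_ ?_)
          · have := hE0 τ
            have := hl τ
            positivity
          · rw [abs_le]
            constructor <;> unfold len <;> linarith [hx.1, hx.2, hy.1, hy.2]
          · exact (hlip τ x hx y hy).trans_eq (by ring)
      _ = ENNReal.ofReal (C / T.len τ ^ 3 * E τ * T.len τ ^ (1 - 2 * s) * T.len τ * T.len τ) := by
          have := hE0 τ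
          have := hl τ
          rw [setLIntegral_const, setLIntegral_const, T.volume_piece,
            ← ENNReal.ofReal_mul (by positivity), ← ENNReal.ofReal_mul (by positivity)]
      _ ≤ _ := by
          refine ENNReal.ofReal_le_ofReal (le_of_eq ?_)
          have := (hl τ).ne'
          rw [sub_eq_add_neg, Real.rpow_add (hl τ), Real.rpow_one]
          field_simp
  have hoff : ∀ τ σ, ∫⁻ x in T.piece τ, ∫⁻ y in T.piece σ, f (x, y) ≤
      (2 * S τ + 2 * S σ) * W τ σ := by
    intro τ σ
    have h0 : ∀ τ, 0 ≤ C / T.len τ * E τ := fun τ => by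
      have := hE0 τ
      have := hl τ
      positivity
    have hc : 2 * S τ + 2 * S σ =
        ENNReal.ofReal (2 * (C / T.len τ * E τ) + 2 * (C / T.len σ * E σ)) := by
      rw [ENNReal.ofReal_add (mul_nonneg zero_le_two (h0 τ)) (mul_nonneg zero_le_two (h0 σ)),
        ENNReal.ofReal_mul zero_le_two, ENNReal.ofReal_mul zero_le_two, ENNReal.ofReal_ofNat]
    rw [hc, hW]
    simp only
    rw [← lintegral_const_mul' _ _ ENNReal.ofReal_ne_top]
    simp only [← lintegral_const_mul' _ _ ENNReal.ofReal_ne_top]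
    refine setLIntegral_mono' (T.measurableSet_piece τ) fun x hx =>
      setLIntegral_mono' (T.measurableSet_piece σ) fun y hy => ?_
    exact slobIntegrand_le_mul_singKernel (hsup τ x hx) (hsup σ y hy)
  calc ∫⁻ p in Om ×ˢ Om, f p
      = ∑ τ, ∑ σ, ∫⁻ x in T.piece τ, ∫⁻ y in T.piece σ, f (x, y) := hsplit
    _ ≤ ∑ τ, (ENNReal.ofReal (C * E τ * T.len τ ^ (-(2 * s))) +
          ∑ σ ∈ Finset.univ.erase τ, (2 * S τ + 2 * S σ) * W τ σ) := by
        refine Finset.sum_le_sum fun τ _ => ?_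
        rw [← Finset.add_sum_erase _ _ (Finset.mem_univ τ)]
        exact add_le_add (hdiag τ) (Finset.sum_le_sum fun σ _ => hoff τ σ)
    _ = ∑ τ, (ENNReal.ofReal (C * E τ * T.len τ ^ (-(2 * s))) +
          4 * S τ * ∑ σ ∈ Finset.univ.erase τ, W τ σ) := by
        rw [Finset.sum_add_distrib, sum_sum_erase_add_mul S W (T.lintegral_singKernel_symm s),
          ← Finset.sum_add_distrib]
    _ ≤ ∑ τ, ENNReal.ofReal
          (C * (1 + 4 / (s * (1 - 2 * s))) * T.Cqu ^ (2 * s) * T.h ^ (-(2 * s)) * E τ) := by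
        refine Finset.sum_le_sum fun τ _ => ?_
        have h1 := hE0 τ
        have h2 := hl τ
        have h3 : 4 * S τ * ∑ σ ∈ Finset.univ.erase τ, W τ σ ≤
            ENNReal.ofReal (4 * (C / T.len τ * E τ) *
              (T.len τ ^ (1 - 2 * s) / (s * (1 - 2 * s)))) := by
          rw [ENNReal.ofReal_mul (by positivity), ENNReal.ofReal_mul (by positivity)]
          simp only [hS, ENNReal.ofReal_ofNat]
          gcongr
          exact T.sum_lintegral_singKernel_le hs0 hs τ
        refine (add_le_add_right h3 _).trans ?_
        rw [← ENNReal.ofReal_add (by positivity) (by positivity)]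
        refine ENNReal.ofReal_le_ofReal ?_
        -- The `1` is the diagonal block; `4 / (s (1 - 2s))` is the interaction with all other
        -- elements.
        calc _ = C * (1 + 4 / (s * (1 - 2 * s))) * E τ * T.len τ ^ (-(2 * s)) := by
              rw [sub_eq_add_neg 1 (2 * s), Real.rpow_add h2, Real.rpow_one]
              field_simp
          _ ≤ C * (1 + 4 / (s * (1 - 2 * s))) * E τ * (T.Cqu ^ (2 * s) * T.h ^ (-(2 * s))) := by
              have := T.len_rpow_le hs0 τ
              gcongr
          _ = _ := by ring
    _ = _ := by
        have h1 : 0 ≤ T.Cqu := by linarith [T.one_le_Cqu]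
        have h2 := T.h_pos
        rw [T.integral_Om hint, ← ENNReal.ofReal_sum_of_nonneg, Finset.mul_sum]
        intro τ _
        have := hE0 τ
        positivity

end Mesh

end Seminorm

end AbelFEM

/-! ### The dual norm and the inverse inequality -/

namespace AbelFEM

section DualNorm

variable {𝕜 : Type*} [RCLike 𝕜]

lemma measurableSet_Om : MeasurableSet Om := measurableSet_Ioo

instance : IsFiniteMeasure (volume.restrict Om) :=
  ⟨by simp [Om]⟩

lemma l2norm_nonneg (u : ℝ → 𝕜) : 0 ≤ l2norm u := Real.sqrt_nonneg _

lemma l2norm_sq (u : ℝ → 𝕜) : l2norm u ^ 2 = ∫ x in Om, ‖u x‖ ^ 2 :=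
  Real.sq_sqrt (integral_nonneg fun _ => sq_nonneg _)

lemma HsNorm_nonneg (s : ℝ) (v : ℝ → 𝕜) : 0 ≤ HsNorm s v := Real.sqrt_nonneg _

lemma l2norm_le_HsNorm (s : ℝ) (v : ℝ → 𝕜) : l2norm v ≤ HsNorm s v :=
  Real.sqrt_le_sqrt (le_add_of_nonneg_right
    (integral_nonneg fun p => slobIntegrand_nonneg s v p))

lemma norm_l2inner_le {u v : ℝ → 𝕜} (hu : MemLp u 2 (volume.restrict Om))
    (hv : MemLp v 2 (volume.restrict Om)) : ‖l2inner u v‖ ≤ l2norm u * l2norm v := by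
  have h2 : ENNReal.ofReal 2 = 2 := by norm_num
  have h1 := integral_mul_le_Lp_mul_Lq_of_nonneg (μ := volume.restrict Om)
    Real.HolderConjugate.two_two (f := fun x => ‖u x‖) (g := fun x => ‖v x‖)
    (.of_forall fun x => norm_nonneg _) (.of_forall fun x => norm_nonneg _)
    (h2 ▸ hu.norm) (h2 ▸ hv.norm)
  simp only [Real.rpow_two, ← Real.sqrt_eq_rpow] at h1
  refine (norm_integral_le_integral_norm _).trans (le_trans (le_of_eq ?_) h1)
  simp

lemma HsDualNorm_nonneg (s : ℝ) (u : ℝ → 𝕜) : 0 ≤ HsDualNorm s u := by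
  refine Real.sSup_nonneg ?_
  rintro _ ⟨v, _, hv, rfl⟩
  positivity

/-- If `HsNorm s v = 0`, then `v` is excluded from the supremum, but its `L²` norm vanishes and so
does the left side. -/
lemma norm_l2inner_le_HsDualNorm {s : ℝ} {u v : ℝ → 𝕜} (hu : MemLp u 2 (volume.restrict Om))
    (hv : MemHs s v) : ‖l2inner u v‖ ≤ HsDualNorm s u * HsNorm s v := by
  rcases (HsNorm_nonneg s v).eq_or_lt with h | h
  · have h1 := norm_l2inner_le hu hv.1
    have h2 := l2norm_le_HsNorm s v
    have h3 : l2norm v = 0 := le_antisymm (h ▸ h2) (l2norm_nonneg v)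
    rw [h3, mul_zero] at h1
    rw [← h, mul_zero]
    exact h1
  · rw [← div_le_iff₀ h]
    -- Boundedness is essential, since a real `sSup` of an unbounded set is 0. The `L²` norm of `u`
    -- is an upper bound.
    refine le_csSup ⟨l2norm u, ?_⟩ ⟨v, hv, h, rfl⟩
    rintro _ ⟨w, hw, hw0, rfl⟩
    rw [div_le_iff₀ hw0]
    refine (norm_l2inner_le hu hw.1).trans ?_
    exact mul_le_mul_of_nonneg_left (l2norm_le_HsNorm s w) (l2norm_nonneg u)

namespace Mesh

variable (T : Mesh)

/-- A function in the finite element space has a bounded measurable representative which is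
polynomial on each open element. -/
lemma exists_representative {m : ℕ} {u : ℝ → 𝕜} (hu : u ∈ T.feSpace 𝕜 m) :
    ∃ U : ℝ → 𝕜, Measurable U ∧ (∃ B, ∀ x, ‖U x‖ ≤ B) ∧ (∀ τ, ∀ x ∈ T.piece τ, U x = u x) := by
  choose p hp hpu using hu.1
  have hcont : ∀ τ, Continuous fun t : ℝ => (p τ).eval (t : 𝕜) := fun τ =>
    (p τ).continuous.comp RCLike.continuous_ofReal
  have hB : ∀ τ, ∃ B, ∀ x ∈ T.piece τ, ‖(p τ).eval (x : 𝕜)‖ ≤ B := fun τ => by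
    obtain ⟨B, hB⟩ := (isCompact_Icc (a := T.x τ) (b := T.x (τ + 1))).exists_bound_of_continuousOn
      (hcont τ).continuousOn
    exact ⟨B, fun x hx => hB x (Ioo_subset_Icc_self hx)⟩
  choose B hB using hB
  -- Zero at the mesh points and outside `[0, 1]`, where `u` is arbitrary and may even fail to be
  -- measurable.
  refine ⟨fun x => ∑ τ, (T.piece τ).indicator (fun t : ℝ => (p τ).eval (t : 𝕜)) x, ?_,
    ⟨∑ τ, |B τ|, fun x => ?_⟩, fun τ x hx => ?_⟩
  · exact Finset.measurable_fun_sum _ fun τ _ =>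
      (hcont τ).measurable.indicator (T.measurableSet_piece τ)
  · refine norm_sum_le_of_le _ fun τ _ => ?_
    by_cases hx : x ∈ T.piece τ
    · rw [indicator_of_mem hx]
      exact (hB τ x hx).trans (le_abs_self _)
    · rw [indicator_of_notMem hx, norm_zero]
      exact abs_nonneg _
  · simp only
    rw [Finset.sum_eq_single τ, indicator_of_mem hx, hpu τ x hx]
    · intro σ _ hne
      exact indicator_of_notMem
        (fun h => Set.disjoint_left.1 (T.pairwise_disjoint_piece hne) h hx) _
    · simp

lemma ae_eq_of_eqOn_piece {β : Type*} {u v : ℝ → β} (h : ∀ τ, ∀ x ∈ T.piece τ, u x = v x) :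
    u =ᵐ[volume.restrict Om] v := by
  filter_upwards [T.ae_Om_exists_piece] with x ⟨τ, hx⟩
  exact h τ x hx

lemma memLp_of_mem_feSpace {m : ℕ} {u : ℝ → 𝕜} (hu : u ∈ T.feSpace 𝕜 m) (p : ENNReal) :
    MemLp u p (volume.restrict Om) := by
  obtain ⟨U, hUm, ⟨B, hB⟩, hUu⟩ := T.exists_representative hu
  exact (MemLp.of_bound hUm.aestronglyMeasurable B (.of_forall hB)).ae_eq
    (T.ae_eq_of_eqOn_piece hUu)

lemma integrableOn_norm_sq_of_mem_feSpace {m : ℕ} {u : ℝ → 𝕜} (hu : u ∈ T.feSpace 𝕜 m) :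
    IntegrableOn (fun x => ‖u x‖ ^ 2) Om :=
  (T.memLp_of_mem_feSpace hu 2).integrable_norm_pow two_ne_zero

lemma norm_sq_le_of_mem_piece {m : ℕ} {C : ℝ}
    (hC : PolynomialBounds 𝕜 m C)
    {u : ℝ → 𝕜} (hu : u ∈ T.feSpace 𝕜 m) (τ : Fin T.N) :
    ∀ x ∈ T.piece τ, ∀ y ∈ T.piece τ,
      ‖u x‖ ^ 2 ≤ C / T.len τ * ∫ t in T.piece τ, ‖u t‖ ^ 2 ∧
      ‖u x - u y‖ ^ 2 ≤ C / T.len τ ^ 3 * |x - y| ^ 2 * ∫ t in T.piece τ, ‖u t‖ ^ 2 := by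
  intro x hx y hy
  obtain ⟨p, hp, hpu⟩ := hu.1 τ
  have hI : ∫ t in T.piece τ, ‖u t‖ ^ 2 = ∫ t in T.piece τ, ‖p.eval (t : 𝕜)‖ ^ 2 :=
    setIntegral_congr_fun (T.measurableSet_piece τ) fun t ht => by simp only [hpu t ht]
  rw [hI, hpu x hx, hpu y hy]
  exact hC p hp _ _ (T.x_lt τ τ.2) x (Ioo_subset_Icc_self hx) y (Ioo_subset_Icc_self hy)

/-- The inverse inequality between `L²(Ω)` and `H^{-s}(Ω)`. -/
lemma l2norm_le_HsDualNorm {s C : ℝ} (hs0 : 0 < s) (hs : s < 1 / 2) (hC : 0 < C) {m : ℕ}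
    (hCb : PolynomialBounds 𝕜 m C)
    {u : ℝ → 𝕜} (hu : u ∈ T.feSpace 𝕜 m) :
    l2norm u ≤ Real.sqrt (1 + C * (1 + 4 / (s * (1 - 2 * s))) * T.Cqu ^ (2 * s)) *
      T.h ^ (-s) * HsDualNorm s u := by
  obtain ⟨U, hUm, ⟨B, hB⟩, hUu⟩ := T.exists_representative hu
  have hs1 : 0 < 1 - 2 * s := by linarith
  have hh := T.h_pos
  have hq : 0 ≤ T.Cqu := by linarith [T.one_le_Cqu]
  have hae := T.ae_eq_of_eqOn_piece hUu
  have hL2 : MemLp U 2 (volume.restrict Om) :=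
    MemLp.of_bound hUm.aestronglyMeasurable B (.of_forall hB)
  have hnorm : l2norm U = l2norm u := by
    unfold l2norm
    congr 1
    refine integral_congr_ae ?_
    filter_upwards [hae] with x hx
    rw [hx]
  set A := C * (1 + 4 / (s * (1 - 2 * s))) * T.Cqu ^ (2 * s) with hA
  have hA0 : 0 ≤ A := by positivity
  have hpiece : ∀ τ, ∫ t in T.piece τ, ‖U t‖ ^ 2 = ∫ t in T.piece τ, ‖u t‖ ^ 2 := fun τ =>
    setIntegral_congr_fun (T.measurableSet_piece τ) fun t ht => by simp only [hUu τ t ht]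
  have hlint : ∫⁻ p in Om ×ˢ Om, ENNReal.ofReal (slobIntegrand s U p) ≤
      ENNReal.ofReal (A * T.h ^ (-(2 * s)) * ∫ x in Om, ‖U x‖ ^ 2) := by
    refine T.lintegral_slobIntegrand_le hs0 hs hC hUm (hL2.integrable_norm_pow two_ne_zero) ?_ ?_
    · intro τ x hx
      rw [hpiece, hUu τ x hx]
      exact (T.norm_sq_le_of_mem_piece hCb hu τ x hx x hx).1
    · intro τ x hx y hy
      rw [hpiece, hUu τ x hx, hUu τ y hy]
      exact (T.norm_sq_le_of_mem_piece hCb hu τ x hx y hy).2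
  -- The finite bound on the lower integral makes `U` an admissible test function.
  have hmem : MemHs s U := by
    refine ⟨hL2, (measurable_slobIntegrand s hUm).aestronglyMeasurable, ?_⟩
    rw [hasFiniteIntegral_iff_ofReal (.of_forall (slobIntegrand_nonneg s U))]
    exact hlint.trans_lt ENNReal.ofReal_lt_top
  have hHs : HsNorm s U ≤ Real.sqrt (1 + A) * T.h ^ (-s) * l2norm u := by
    have h1 : ∫ p in Om ×ˢ Om, slobIntegrand s U p ≤ A * T.h ^ (-(2 * s)) * l2norm u ^ 2 := by
      rw [integral_eq_lintegral_of_nonneg_ae (.of_forall (slobIntegrand_nonneg s U))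
        (measurable_slobIntegrand s hUm).aestronglyMeasurable, ← hnorm, l2norm_sq]
      refine ENNReal.toReal_le_of_le_ofReal ?_ hlint
      have : 0 ≤ ∫ x in Om, ‖U x‖ ^ 2 := integral_nonneg fun _ => sq_nonneg _
      positivity
    -- As `h ≤ 1`, the `L²` part of the `H^s` norm is absorbed into the factor `h^{-2s}` of the
    -- seminorm.
    have h2 : 1 ≤ T.h ^ (-(2 * s)) :=
      Real.one_le_rpow_of_pos_of_le_one_of_nonpos hh T.h_le_one (by linarith)
    have h3 : (T.h ^ (-s)) ^ 2 = T.h ^ (-(2 * s)) := by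
      rw [← Real.rpow_natCast, ← Real.rpow_mul hh.le]
      congr 1
      push_cast
      ring
    refine Real.sqrt_le_iff.2 ⟨mul_nonneg (by positivity) (l2norm_nonneg u), ?_⟩
    rw [mul_pow, mul_pow, Real.sq_sqrt (by positivity), h3, ← l2norm_sq, hnorm]
    nlinarith [sq_nonneg (l2norm u)]
  have hinner : ‖l2inner u U‖ = l2norm u ^ 2 := by
    have h1 : l2inner u U = ((∫ x in Om, ‖u x‖ ^ 2 : ℝ) : 𝕜) := by
      rw [← integral_ofReal]
      refine integral_congr_ae ?_
      filter_upwards [hae] with x hx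
      simp only [hx, RCLike.mul_conj]
      push_cast
      rfl
    rw [h1, ← l2norm_sq, RCLike.norm_ofReal, abs_of_nonneg (sq_nonneg _)]
  have hdual := norm_l2inner_le_HsDualNorm (T.memLp_of_mem_feSpace hu 2) hmem
  have hd0 := HsDualNorm_nonneg s u
  rcases (l2norm_nonneg u).eq_or_lt with h | h
  · rw [← h]
    positivity
  · rw [hinner, pow_two] at hdual
    have h4 : l2norm u * l2norm u ≤
        (Real.sqrt (1 + A) * T.h ^ (-s) * HsDualNorm s u) * l2norm u := by
      calc _ ≤ HsDualNorm s u * (Real.sqrt (1 + A) * T.h ^ (-s) * l2norm u) :=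
            hdual.trans (mul_le_mul_of_nonneg_left hHs hd0)
        _ = _ := by ring
    exact le_of_mul_le_mul_right h4 h

end Mesh

end DualNorm

end AbelFEM

/-! ### The Lagrange basis and nodal expansion -/

namespace AbelFEM

namespace Mesh

section LagrangeBasis

variable (T : Mesh) {𝕜 : Type*} [RCLike 𝕜]

/-- The case `j = m` is included: its number `(i + 1) m` belongs to the next block in the definition
of `node`, and both formulas give `x (i + 1)`. -/
lemma node_add {m : ℕ} (hm : 1 ≤ m) (i : ℕ) {j : ℕ} (hj : j ≤ m) :
    T.node m (i * m + j) = T.x i + j * ((T.x (i + 1) - T.x i) / m) := by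
  have hm0 : m ≠ 0 := by omega
  rw [node, if_neg hm0]
  rcases hj.lt_or_eq with h | rfl
  · rw [mul_comm i m, Nat.mul_add_div (by omega), Nat.mul_add_mod, Nat.div_eq_of_lt h,
      Nat.mod_eq_of_lt h, add_zero]
  · have h1 : (i * j + j) / j = i + 1 := by
      rw [← Nat.succ_mul]
      exact Nat.mul_div_cancel _ (by omega)
    have h2 : (i * j + j) % j = 0 := by
      rw [← Nat.succ_mul]
      exact Nat.mul_mod_left _ _
    have h3 : (j : ℝ) ≠ 0 := by exact_mod_cast hm0
    rw [h1, h2]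
    rw [Nat.cast_zero, zero_mul, add_zero, mul_div_cancel₀ _ h3]
    ring

lemma exists_eq_mul_add {m i k : ℕ} (hm : 1 ≤ m) (hk : k ∈ localDofs m i) :
    ∃ j ≤ m, k = i * m + j := by
  rw [localDofs, if_neg (by omega), Finset.mem_Icc] at hk
  exact ⟨k - i * m, by omega, by omega⟩

lemma card_localDofs (m i : ℕ) : (localDofs m i).card = m + 1 := by
  unfold localDofs
  split_ifs with h
  · simp [h]
  · rw [Nat.card_Icc]
    omega

lemma lt_dim_of_mem_localDofs {m k : ℕ} (τ : Fin T.N) (hk : k ∈ localDofs m τ) :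
    k < T.dim m := by
  unfold localDofs at hk
  unfold dim
  split_ifs at hk ⊢ with h
  · rw [Finset.mem_singleton.1 hk]
    exact τ.2
  · have h1 : (τ + 1) * m ≤ T.N * m := Nat.mul_le_mul_right m τ.2
    have h2 := (Finset.mem_Icc.1 hk).2
    rw [Nat.succ_mul] at h1
    omega

lemma injOn_node (m : ℕ) (τ : Fin T.N) : Set.InjOn (T.node m) (localDofs m τ) := by
  intro k hk l hl hkl
  rcases Nat.eq_zero_or_pos m with rfl | hm
  · simp only [localDofs, if_true, Finset.coe_singleton, mem_singleton_iff] at hk hl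
    rw [hk, hl]
  · obtain ⟨j, hj, rfl⟩ := exists_eq_mul_add hm hk
    obtain ⟨j', hj', rfl⟩ := exists_eq_mul_add hm hl
    rw [T.node_add hm _ hj, T.node_add hm _ hj'] at hkl
    have h1 : 0 < (T.x (τ + 1) - T.x τ) / m :=
      div_pos (T.len_pos τ) (by exact_mod_cast hm)
    have h2 := mul_right_cancel₀ h1.ne' (add_left_cancel hkl)
    have h3 : j = j' := by exact_mod_cast h2
    rw [h3]

lemma node_mem_elem {m k : ℕ} (τ : Fin T.N) (hk : k ∈ localDofs m τ) :
    T.node m k ∈ T.elem τ := by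
  have hl := T.x_lt τ τ.2
  rcases Nat.eq_zero_or_pos m with rfl | hm
  · simp only [localDofs, if_true, Finset.mem_singleton] at hk
    rw [hk, node, if_pos rfl]
    constructor <;> linarith
  · obtain ⟨j, hj, rfl⟩ := exists_eq_mul_add hm hk
    rw [T.node_add hm _ hj]
    have hm' : (0 : ℝ) < m := by exact_mod_cast hm
    have hj' : (j : ℝ) ≤ m := by exact_mod_cast hj
    have h1 : 0 ≤ (T.x (τ + 1) - T.x τ) / m := div_nonneg (T.len_pos τ).le hm'.le
    have h2 : (m : ℝ) * ((T.x (τ + 1) - T.x τ) / m) = T.x (τ + 1) - T.x τ := by field_simp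
    have h3 : (j : ℝ) * ((T.x (τ + 1) - T.x τ) / m) ≤ m * ((T.x (τ + 1) - T.x τ) / m) := by
      gcongr
    constructor
    · have : 0 ≤ (j : ℝ) * ((T.x (τ + 1) - T.x τ) / m) := by positivity
      linarith
    · linarith

lemma elem_subset_Icc (τ : Fin T.N) : T.elem τ ⊆ Icc 0 1 :=
  Icc_subset_Icc (T.x_nonneg τ.2.le) (T.x_le_one τ.2)

/-- For `m = 0` the node is interior. For `m ≥ 1` it may be an end point, and continuity carries the
polynomial identity to the closed element. -/
lemma eq_eval_node {m k : ℕ} {u : ℝ → 𝕜} (hu : u ∈ T.feSpace 𝕜 m) (τ : Fin T.N) {p : 𝕜[X]}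
    (hp : ∀ x ∈ T.piece τ, u x = p.eval (x : 𝕜)) (hk : k ∈ localDofs m τ) :
    u (T.node m k) = p.eval (T.node m k : 𝕜) := by
  rcases Nat.eq_zero_or_pos m with rfl | hm
  · refine hp _ ?_
    have hl := T.x_lt τ τ.2
    simp only [localDofs, if_true, Finset.mem_singleton] at hk
    rw [hk, node, if_pos rfl]
    constructor <;> linarith
  · have h1 : EqOn u (fun x : ℝ => p.eval (x : 𝕜)) (T.elem τ) := by
      refine EqOn.of_subset_closure (s := T.piece τ) hp
        ((hu.2 hm).mono (T.elem_subset_Icc τ))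
        (p.continuous.comp RCLike.continuous_ofReal).continuousOn Ioo_subset_Icc_self ?_
      rw [piece, closure_Ioo (T.x_lt τ τ.2).ne]
      exact subset_rfl
    exact h1 (T.node_mem_elem τ hk)

lemma piece_subset_cell (τ : Fin T.N) : T.piece τ ⊆ T.cell τ := by
  unfold cell
  split_ifs
  · exact Ioo_subset_Icc_self
  · exact Ioo_subset_Ioc_self

lemma cell_subset_elem (τ : Fin T.N) : T.cell τ ⊆ T.elem τ := by
  unfold cell
  split_ifs
  · exact subset_rfl
  · exact Ioc_subset_Icc_self

lemma measurableSet_cell (τ : Fin T.N) : MeasurableSet (T.cell τ) := by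
  unfold cell
  split_ifs
  · exact measurableSet_Icc
  · exact measurableSet_Ioc

lemma notMem_cell_of_mem_piece {τ σ : Fin T.N} (hne : σ ≠ τ) {x : ℝ} (hx : x ∈ T.piece τ) :
    x ∉ T.cell σ := by
  intro h
  have h' := T.cell_subset_elem σ h
  rcases lt_or_gt_of_ne hne with h1 | h1
  · exact absurd (h'.2.trans (T.x_le (Nat.succ_le_of_lt h1) τ.2.le)) (not_le.2 hx.1)
  · exact absurd ((T.x_le (Nat.succ_le_of_lt h1) σ.2.le).trans h'.1) (not_le.2 hx.2)

lemma basisFun_of_mem_piece {m : ℕ} (k : Fin (T.dim m)) {τ : Fin T.N} {x : ℝ}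
    (hx : x ∈ T.piece τ) : T.basisFun m k x = (T.shape m τ k).eval x := by
  rw [basisFun, Finset.sum_eq_single τ, indicator_of_mem (T.piece_subset_cell τ hx)]
  · intro σ _ hne
    exact indicator_of_notMem (T.notMem_cell_of_mem_piece hne hx) _
  · simp

lemma measurable_basisFun {m : ℕ} (k : Fin (T.dim m)) : Measurable (T.basisFun m k) := by
  unfold basisFun
  exact Finset.measurable_fun_sum _ fun τ _ =>
    (T.shape m τ k).continuous.measurable.indicator (T.measurableSet_cell τ)

lemma exists_abs_basisFun_le {m : ℕ} (k : Fin (T.dim m)) :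
    ∃ B, ∀ x, |T.basisFun m k x| ≤ B := by
  have hB : ∀ τ : Fin T.N, ∃ B, ∀ x ∈ T.elem τ, ‖(T.shape m τ k).eval x‖ ≤ B := fun τ =>
    (isCompact_Icc (a := T.x τ) (b := T.x (τ + 1))).exists_bound_of_continuousOn
      (T.shape m τ k).continuous.continuousOn
  choose B hB using hB
  refine ⟨∑ τ, |B τ|, fun x => ?_⟩
  rw [← Real.norm_eq_abs]
  refine norm_sum_le_of_le _ fun τ _ => ?_
  by_cases hx : x ∈ T.cell τ
  · rw [indicator_of_mem hx]
    exact (hB τ x (T.cell_subset_elem τ hx)).trans (le_abs_self _)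
  · rw [indicator_of_notMem hx, norm_zero]
    exact abs_nonneg _

/-- Otherwise the basis function vanishes near the midpoint of `τ`, which then lies outside the
support. -/
lemma mem_localDofs_of_mem_idx {m : ℕ} {τ : Fin T.N} {k : Fin (T.dim m)} (hk : k ∈ T.idx m τ) :
    (k : ℕ) ∈ localDofs m τ := by
  by_contra h
  have hl := T.x_lt τ τ.2
  have hmid : (T.x τ + T.x (τ + 1)) / 2 ∈ T.piece τ := by
    constructor <;> linarith
  have h1 : (T.x τ + T.x (τ + 1)) / 2 ∈ tsupport (T.basisFun m k) :=
    hk (Ioo_subset_Icc_self hmid)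
  refine notMem_tsupport_iff_eventuallyEq.2 ?_ h1
  filter_upwards [isOpen_Ioo.mem_nhds hmid] with x hx
  rw [T.basisFun_of_mem_piece k hx, shape, if_neg h]
  simp

/-- The shape polynomial is nonzero, so its zeros are finite in number and their complement is dense
in the element. -/
lemma mem_idx_of_mem_localDofs {m : ℕ} {τ : Fin T.N} {k : Fin (T.dim m)}
    (hk : (k : ℕ) ∈ localDofs m τ) : k ∈ T.idx m τ := by
  have hne : T.shape m τ k ≠ 0 := by
    rw [shape, if_pos hk]
    exact Lagrange.basis_ne_zero (T.injOn_node m τ) hk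
  have hfin : {x | (T.shape m τ k).IsRoot x}.Finite := by
    refine (T.shape m τ k).roots.toFinset.finite_toSet.subset fun x hx => ?_
    simpa [hne] using hx
  have hdense : Dense {x | (T.shape m τ k).IsRoot x}ᶜ := hfin.countable.dense_compl ℝ
  have h1 : T.piece τ ⊆ closure (T.piece τ ∩ {x | (T.shape m τ k).IsRoot x}ᶜ) :=
    hdense.open_subset_closure_inter isOpen_Ioo
  have h2 : T.piece τ ∩ {x | (T.shape m τ k).IsRoot x}ᶜ ⊆
      Function.support (T.basisFun m k) := by
    rintro x ⟨hx, hx'⟩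
    rw [Function.mem_support, T.basisFun_of_mem_piece k hx]
    exact hx'
  have h3 := closure_minimal (h1.trans (closure_mono h2)) isClosed_closure
  rw [piece, closure_Ioo (T.x_lt τ τ.2).ne] at h3
  exact h3

lemma mem_idx_iff {m : ℕ} {τ : Fin T.N} {k : Fin (T.dim m)} :
    k ∈ T.idx m τ ↔ (k : ℕ) ∈ localDofs m τ :=
  ⟨T.mem_localDofs_of_mem_idx, T.mem_idx_of_mem_localDofs⟩

lemma basisFun_eq_zero {m : ℕ} {τ : Fin T.N} {k : Fin (T.dim m)} (hk : k ∉ T.idx m τ) {x : ℝ}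
    (hx : x ∈ T.piece τ) : T.basisFun m k x = 0 := by
  rw [T.mem_idx_iff] at hk
  rw [T.basisFun_of_mem_piece k hx, shape, if_neg hk, eval_zero]

lemma eval_shape_node {m k l : ℕ} (τ : Fin T.N) (hl : l ∈ localDofs m τ) :
    (T.shape m τ k).eval (T.node m l) = if k = l then 1 else 0 := by
  unfold shape
  split_ifs with h1 h2 h2
  · subst h2
    exact Lagrange.eval_basis_self (T.injOn_node m τ) hl
  · exact Lagrange.eval_basis_of_ne h2 hl
  · exact absurd (h2 ▸ hl) h1
  · exact eval_zero

lemma natDegree_shape_le (m k : ℕ) (τ : Fin T.N) : (T.shape m τ k).natDegree ≤ m := by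
  unfold shape
  split_ifs with h
  · rw [Lagrange.natDegree_basis (T.injOn_node m τ) h, card_localDofs]
    omega
  · simp

/-- A finite element function is the sum of its nodal values times the Lagrange basis. -/
lemma eq_sum_node_mul_basisFun {m : ℕ} {u : ℝ → 𝕜} (hu : u ∈ T.feSpace 𝕜 m) {τ : Fin T.N} {x : ℝ}
    (hx : x ∈ T.piece τ) :
    u x = ∑ k : Fin (T.dim m), u (T.node m k) * (T.basisFun m k x : 𝕜) := by
  obtain ⟨p, hp, hpu⟩ := hu.1 τ
  set q : 𝕜[X] := ∑ k : Fin (T.dim m),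
    Polynomial.C (u (T.node m k)) * (T.shape m τ k).map (algebraMap ℝ 𝕜) with hq
  have hqe : ∀ t : ℝ, q.eval (t : 𝕜) =
      ∑ k : Fin (T.dim m), u (T.node m k) * (((T.shape m τ k).eval t : ℝ) : 𝕜) := by
    intro t
    rw [hq, Polynomial.eval_finsetSum]
    refine Finset.sum_congr rfl fun k _ => ?_
    rw [eval_mul, eval_C]
    congr 1
    exact Polynomial.eval_map_apply (algebraMap ℝ 𝕜) t
  have hqd : q.natDegree ≤ m := by
    refine Polynomial.natDegree_sum_le_of_forall_le _ _ fun k _ => ?_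
    refine (Polynomial.natDegree_C_mul_le _ _).trans ?_
    exact (Polynomial.natDegree_map_le).trans (T.natDegree_shape_le m k τ)
  have hdeg : ∀ r : 𝕜[X], r.natDegree ≤ m → r.degree < (localDofs m τ).card := by
    intro r hr
    rw [card_localDofs]
    refine Polynomial.degree_le_natDegree.trans_lt ?_
    exact_mod_cast Nat.lt_succ_of_le hr
  -- Two polynomials of degree at most `m` that agree at the `m + 1` distinct nodes of the element.
  have hpq : p = q := by
    refine Polynomial.eq_of_degrees_lt_of_eval_index_eq (localDofs m τ)
      (v := fun k => (T.node m k : 𝕜))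
      (fun k hk l hl h => T.injOn_node m τ hk hl (RCLike.ofReal_injective h))
      (hdeg p hp) (hdeg q hqd) fun l hl => ?_
    rw [hqe, ← T.eq_eval_node hu τ hpu hl,
      Finset.sum_eq_single ⟨l, T.lt_dim_of_mem_localDofs τ hl⟩]
    · simp [T.eval_shape_node τ hl]
    · intro k _ hk
      rw [T.eval_shape_node τ hl, if_neg (fun h => hk (Fin.ext h))]
      simp
    · simp
  rw [hpu x hx, hpq, hqe]
  exact Finset.sum_congr rfl fun k _ => by rw [T.basisFun_of_mem_piece k hx]

end LagrangeBasis

end Mesh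

end AbelFEM

/-! ### Integrability of the Abel kernel -/

namespace AbelFEM

section AbelKernel

/-- The real Abel integral `∫₀ˣ (x - y)^(α - 1) K(x, y) φ(y) dy`. -/
noncomputable def abelInt (K : ℝ → ℝ → ℝ) (α : ℝ) (φ : ℝ → ℝ) (x : ℝ) : ℝ :=
  ∫ y in Ioo 0 x, (x - y) ^ (α - 1) * K x y * φ y

/-- The triangle `0 < y < x < 1`. -/
def triangle : Set (ℝ × ℝ) := {p : ℝ × ℝ | 0 < p.2 ∧ p.2 < p.1 ∧ p.1 < 1}

lemma measurableSet_triangle : MeasurableSet triangle :=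
  (measurableSet_lt measurable_const measurable_snd).inter
    ((measurableSet_lt measurable_snd measurable_fst).inter
      (measurableSet_lt measurable_fst measurable_const))

lemma indicator_triangle {x : ℝ} (hx : x ∈ Om) (g : ℝ × ℝ → ℝ) (y : ℝ) :
    triangle.indicator g (x, y) = (Ioo 0 x).indicator (fun y => g (x, y)) y := by
  by_cases hy : y ∈ Ioo 0 x
  · rw [indicator_of_mem hy, indicator_of_mem (show (x, y) ∈ triangle from ⟨hy.1, hy.2, hx.2⟩)]
  · rw [indicator_of_notMem hy, indicator_of_notMem (fun h => hy ⟨h.1, h.2.1⟩)]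

variable {K : ℝ → ℝ → ℝ} {α : ℝ}

/-- Fubini on the triangle: integrability in `y` is available only for almost every `x`, which
suffices for every later exchange of sum and integral. -/
lemma ae_integrableOn_abel_kernel
    (hK : IntegrableOn (fun p : ℝ × ℝ => (p.1 - p.2) ^ (α - 1) * K p.1 p.2) triangle) :
    ∀ᵐ x ∂(volume.restrict Om),
      IntegrableOn (fun y => (x - y) ^ (α - 1) * K x y) (Ioo 0 x) := by
  have h1 := (integrable_indicator_iff measurableSet_triangle).2 hK
  rw [Measure.volume_eq_prod] at h1
  filter_upwards [ae_restrict_of_ae h1.prod_right_ae, ae_restrict_mem measurableSet_Om]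
    with x hx hxO
  simp only [indicator_triangle hxO] at hx
  exact (integrable_indicator_iff measurableSet_Ioo).1 hx

lemma integrableOn_abelInt
    (hK : IntegrableOn (fun p : ℝ × ℝ => (p.1 - p.2) ^ (α - 1) * K p.1 p.2) triangle)
    {φ : ℝ → ℝ} (hφ : Measurable φ) {B : ℝ} (hB : ∀ x, |φ x| ≤ B) :
    IntegrableOn (abelInt K α φ) Om := by
  have h0 : Integrable (fun p : ℝ × ℝ => (p.1 - p.2) ^ (α - 1) * K p.1 p.2 * φ p.2)
      (volume.restrict triangle) :=
    hK.mul_bdd (c := B) (hφ.comp measurable_snd).aestronglyMeasurable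
      (.of_forall fun p => hB p.2)
  have h1 := (integrable_indicator_iff measurableSet_triangle).2 h0
  rw [Measure.volume_eq_prod] at h1
  refine (h1.integral_prod_left.integrableOn (s := Om)).congr_fun (fun x hx => ?_) measurableSet_Om
  simp only [indicator_triangle hx]
  rw [integral_indicator measurableSet_Ioo, abelInt]

end AbelKernel

end AbelFEM

/-! ### Matrix representation and the consistency estimate -/

namespace AbelFEM

/-- `Γ` is convex with `Γ(1) = Γ(2) = 1`, and 1 lies between `α` and 2. This keeps the final
constant independent of `Γ(α)`. -/
lemma one_le_Gamma {α : ℝ} (hα : α ∈ Ioo (0 : ℝ) 1) : 1 ≤ Real.Gamma α := by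
  have h2 : 0 < 2 - α := by linarith [hα.2]
  have h1 := Real.convexOn_Gamma.2 (show α ∈ Ioi (0 : ℝ) from hα.1)
    (show (2 : ℝ) ∈ Ioi (0 : ℝ) from Set.mem_Ioi.2 two_pos)
    (div_nonneg zero_le_one h2.le : 0 ≤ 1 / (2 - α))
    (div_nonneg (by linarith [hα.2]) h2.le : 0 ≤ (1 - α) / (2 - α))
    (by field_simp; ring)
  have h3 : 1 / (2 - α) * α + (1 - α) / (2 - α) * 2 = 1 := by
    field_simp
    ring
  simp only [smul_eq_mul] at h1
  rw [h3, Real.Gamma_one, Real.Gamma_two, mul_one, ← sub_le_iff_le_add, one_div,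
    le_inv_mul_iff₀ h2, mul_sub, mul_div_cancel₀ _ h2.ne'] at h1
  linarith

namespace Mesh

section Decomposition

variable (T : Mesh) {𝕜 : Type*} [RCLike 𝕜] {K : ℝ → ℝ → ℝ} {α : ℝ}

/-- Moving the restriction `y ∈ σ` into the argument of the Abel integral makes the sum over `σ` a
matter of linearity. -/
lemma localInt_eq (m : ℕ) (τ σ : Fin T.N) (i j : Fin (T.dim m)) :
    T.localInt K α m τ σ i j = ∫ x in T.piece τ,
      T.basisFun m i x * abelInt K α ((T.piece σ).indicator (T.basisFun m j)) x := by
  rw [localInt, setIntegral_congr_set (T.elem_ae_eq_piece τ)]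
  refine setIntegral_congr_fun (T.measurableSet_piece τ) fun x hx => ?_
  have hset : (T.elem σ ∩ Icc 0 x : Set ℝ) =ᵐ[volume] (T.piece σ ∩ Ioo 0 x : Set ℝ) :=
    ae_eq_set_inter (T.elem_ae_eq_piece σ) Ioo_ae_eq_Icc.symm
  rw [setIntegral_congr_set hset, abelInt, ← integral_const_mul,
    ← integral_indicator measurableSet_Ioo,
    ← integral_indicator ((T.measurableSet_piece σ).inter measurableSet_Ioo)]
  congr 1
  funext y
  by_cases h1 : y ∈ T.piece σ <;> by_cases h2 : y ∈ Ioo 0 x <;>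
    simp only [indicator, mem_inter_iff, h1, h2, and_self, and_true, and_false, if_true, if_false,
      mul_zero]
  ring

lemma localInt_eq_zero {m : ℕ} {τ σ : Fin T.N} {i j : Fin (T.dim m)}
    (h : ¬ (i ∈ T.idx m τ ∧ j ∈ T.idx m σ)) : T.localInt K α m τ σ i j = 0 := by
  rw [T.localInt_eq]
  by_cases hi : i ∈ T.idx m τ
  · have hj : j ∉ T.idx m σ := fun hj => h ⟨hi, hj⟩
    have h0 : (T.piece σ).indicator (T.basisFun m j) = 0 :=
      indicator_eq_zero'.2 (Set.disjoint_left.2 fun x hx hx' => hx (T.basisFun_eq_zero hj hx'))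
    simp [h0, abelInt]
  · refine (setIntegral_congr_fun (g := fun _ => (0 : ℝ)) (T.measurableSet_piece τ)
      fun x hx => ?_).trans (by simp)
    simp only [T.basisFun_eq_zero hi hx, zero_mul]

lemma integrableOn_abelInt_basisFun
    (hK : IntegrableOn (fun p : ℝ × ℝ => (p.1 - p.2) ^ (α - 1) * K p.1 p.2) triangle)
    {m : ℕ} (i j : Fin (T.dim m)) {S : Set ℝ} (hS : MeasurableSet S) :
    IntegrableOn (fun x => T.basisFun m i x * abelInt K α (S.indicator (T.basisFun m j)) x) Om := by
  obtain ⟨B, hB⟩ := T.exists_abs_basisFun_le i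
  obtain ⟨B', hB'⟩ := T.exists_abs_basisFun_le j
  refine Integrable.bdd_mul (c := B) ?_ (T.measurable_basisFun i).aestronglyMeasurable
    (.of_forall hB)
  exact integrableOn_abelInt hK ((T.measurable_basisFun j).indicator hS) (B := B')
    fun x => (norm_indicator_le_norm_self (T.basisFun m j) x).trans (hB' x)

/-- The indicators of the open elements add up to 1 almost everywhere in `Ω`; boundedness of the
basis functions provides the integrability needed to exchange sums and integrals. -/
lemma sum_localInt
    (hK : IntegrableOn (fun p : ℝ × ℝ => (p.1 - p.2) ^ (α - 1) * K p.1 p.2) triangle)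
    {m : ℕ} (i j : Fin (T.dim m)) :
    ∑ τ, ∑ σ, T.localInt K α m τ σ i j =
      ∫ x in Om, T.basisFun m i x * abelInt K α (T.basisFun m j) x := by
  have hint := fun S hS => T.integrableOn_abelInt_basisFun hK i j (S := S) hS
  have huniv := hint univ MeasurableSet.univ
  rw [indicator_univ] at huniv
  obtain ⟨B, hB⟩ := T.exists_abs_basisFun_le j
  rw [T.integral_Om huniv]
  refine Finset.sum_congr rfl fun τ _ => ?_
  simp only [T.localInt_eq]
  rw [← integral_finsetSum _ fun σ _ =>
    (hint _ (T.measurableSet_piece σ)).mono_set (T.piece_subset_Om τ)]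
  refine integral_congr_ae ?_
  filter_upwards [ae_restrict_of_ae_restrict_of_subset (T.piece_subset_Om τ)
    (ae_integrableOn_abel_kernel hK), ae_restrict_mem (T.measurableSet_piece τ)] with x hx hxτ
  have hsub : Ioo 0 x ⊆ Om := Ioo_subset_Ioo_right (T.piece_subset_Om τ hxτ).2.le
  rw [← Finset.mul_sum]
  congr 1
  unfold abelInt
  rw [← integral_finsetSum]
  · refine integral_congr_ae ?_
    filter_upwards [ae_restrict_of_ae_restrict_of_subset hsub T.ae_Om_exists_piece] with y ⟨σ, hy⟩
    rw [← Finset.mul_sum, Finset.sum_eq_single σ, indicator_of_mem hy]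
    · intro σ' _ hne
      exact indicator_of_notMem
        (fun h => Set.disjoint_left.1 (T.pairwise_disjoint_piece hne) h hy) _
    · simp
  · intro σ _
    exact hx.mul_bdd (c := B)
      ((T.measurable_basisFun j).indicator (T.measurableSet_piece σ)).aestronglyMeasurable
      (.of_forall fun y => (norm_indicator_le_norm_self (T.basisFun m j) y).trans (hB y))

/-- The matrix representation of the Abel form on the finite element space. -/
lemma abelForm_eq_sum
    (hK : IntegrableOn (fun p : ℝ × ℝ => (p.1 - p.2) ^ (α - 1) * K p.1 p.2) triangle)
    {m : ℕ} {u v : ℝ → 𝕜} (hu : u ∈ T.feSpace 𝕜 m) (hv : v ∈ T.feSpace 𝕜 m) :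
    abelForm K α u v = ∑ i : Fin (T.dim m), ∑ j : Fin (T.dim m),
      (starRingEnd 𝕜) (v (T.node m i)) *
        (((Real.Gamma α)⁻¹ * ∑ τ, ∑ σ, T.localInt K α m τ σ i j : ℝ) : 𝕜) * u (T.node m j) := by
  have hint : ∀ i j : Fin (T.dim m),
      IntegrableOn (fun x => T.basisFun m i x * abelInt K α (T.basisFun m j) x) Om := fun i j => by
    have := T.integrableOn_abelInt_basisFun hK i j MeasurableSet.univ
    rwa [indicator_univ] at this
  have hop : ∀ᵐ x ∂(volume.restrict Om), abelOp K α u x = ∑ j : Fin (T.dim m),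
      ((Real.Gamma α)⁻¹ : 𝕜) * (abelInt K α (T.basisFun m j) x : 𝕜) * u (T.node m j) := by
    filter_upwards [ae_integrableOn_abel_kernel hK, ae_restrict_mem measurableSet_Om] with x hx hxO
    have hsub : Ioo 0 x ⊆ Om := Ioo_subset_Ioo_right hxO.2.le
    have h1 : ∫ y in Ioo 0 x, ((x - y) ^ (α - 1) * K x y) • u y =
        ∫ y in Ioo 0 x, ∑ j : Fin (T.dim m),
          (((x - y) ^ (α - 1) * K x y * T.basisFun m j y : ℝ) : 𝕜) * u (T.node m j) := by
      refine integral_congr_ae ?_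
      filter_upwards [ae_restrict_of_ae_restrict_of_subset hsub T.ae_Om_exists_piece]
        with y ⟨σ, hy⟩
      rw [T.eq_sum_node_mul_basisFun hu hy, RCLike.real_smul_eq_coe_mul, Finset.mul_sum]
      refine Finset.sum_congr rfl fun j _ => ?_
      push_cast
      ring
    rw [abelOp, h1, integral_finsetSum, RCLike.real_smul_eq_coe_mul, Finset.mul_sum]
    · refine Finset.sum_congr rfl fun j _ => ?_
      rw [integral_mul_const, integral_ofReal, ← mul_assoc]
      simp [abelInt]
    · intro j _
      obtain ⟨B, hB⟩ := T.exists_abs_basisFun_le j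
      have h2 : Integrable (fun y => (x - y) ^ (α - 1) * K x y * T.basisFun m j y)
          (volume.restrict (Ioo 0 x)) :=
        hx.mul_bdd (c := B) (T.measurable_basisFun j).aestronglyMeasurable (.of_forall hB)
      exact h2.ofReal.mul_const _
  have hmain : abelForm K α u v = ∫ x in Om, ∑ i : Fin (T.dim m), ∑ j : Fin (T.dim m),
      ((starRingEnd 𝕜) (v (T.node m i)) * ((Real.Gamma α)⁻¹ : 𝕜) * u (T.node m j)) *
        ((T.basisFun m i x * abelInt K α (T.basisFun m j) x : ℝ) : 𝕜) := by
    refine integral_congr_ae ?_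
    filter_upwards [hop, T.ae_Om_exists_piece] with x hx ⟨τ, hτ⟩
    rw [hx, T.eq_sum_node_mul_basisFun hv hτ, map_sum, Finset.mul_sum]
    refine Finset.sum_congr rfl fun i _ => ?_
    rw [Finset.sum_mul]
    refine Finset.sum_congr rfl fun j _ => ?_
    rw [map_mul, RCLike.conj_ofReal]
    push_cast
    ring
  have hint' : ∀ i j : Fin (T.dim m), Integrable (fun x =>
      ((starRingEnd 𝕜) (v (T.node m i)) * ((Real.Gamma α)⁻¹ : 𝕜) * u (T.node m j)) *
        ((T.basisFun m i x * abelInt K α (T.basisFun m j) x : ℝ) : 𝕜))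
      (volume.restrict Om) := fun i j => (hint i j).ofReal.const_mul _
  rw [hmain, integral_finsetSum _ fun i _ => integrable_finsetSum _ fun j _ => hint' i j]
  refine Finset.sum_congr rfl fun i _ => ?_
  rw [integral_finsetSum _ fun j _ => hint' i j]
  refine Finset.sum_congr rfl fun j _ => ?_
  rw [integral_const_mul, integral_ofReal, T.sum_localInt hK]
  push_cast
  ring

lemma abs_localInt_sub_le {m : ℕ} (Q : T.LocalQuad m) {τ σ : Fin T.N} {i j : Fin (T.dim m)}
    (hi : i ∈ T.idx m τ) (hj : j ∈ T.idx m σ) :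
    |T.localInt K α m τ σ i j - Q τ σ i j| ≤ T.errMax K α m Q := by
  have h1 : |T.localInt K α m τ σ i j - Q τ σ i j| ≤ T.localErrMax K α m Q τ σ :=
    le_ciSup (f := fun p : T.idx m τ × T.idx m σ =>
      |T.localInt K α m τ σ p.1 p.2 - Q τ σ p.1 p.2|)
      (Set.finite_range _).bddAbove (⟨i, hi⟩, ⟨j, hj⟩)
  exact h1.trans (le_ciSup (f := fun p : Fin T.N × Fin T.N => T.localErrMax K α m Q p.1 p.2)
    (Set.finite_range _).bddAbove (τ, σ))

lemma errMax_nonneg {m : ℕ} (Q : T.LocalQuad m) : 0 ≤ T.errMax K α m Q :=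
  Real.iSup_nonneg fun _ => Real.iSup_nonneg fun _ => abs_nonneg _

-- Local integrals vanish off the supports, so the exact entry is a sum over the same pairs `(τ, σ)`
-- as the perturbed one. Each pair costs at most `errMax`, and the number of pairs factorises.
open Classical in
lemma abs_sum_localInt_sub_pertEntry_le {m : ℕ} (hα : α ∈ Ioo (0 : ℝ) 1) (Q : T.LocalQuad m)
    (i j : Fin (T.dim m)) :
    |(Real.Gamma α)⁻¹ * ∑ τ, ∑ σ, T.localInt K α m τ σ i j - T.pertEntry α m Q i j| ≤
      T.errMax K α m Q * (∑ τ : Fin T.N, if i ∈ T.idx m τ then (1 : ℝ) else 0) *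
        ∑ σ : Fin T.N, if j ∈ T.idx m σ then (1 : ℝ) else 0 := by
  have hΓ := one_le_Gamma hα
  have hsum : ∑ τ, ∑ σ, T.localInt K α m τ σ i j =
      ∑ τ : Fin T.N with i ∈ T.idx m τ, ∑ σ : Fin T.N with j ∈ T.idx m σ,
        T.localInt K α m τ σ i j := by
    rw [Finset.sum_filter]
    refine Finset.sum_congr rfl fun τ _ => ?_
    rw [Finset.sum_filter]
    split_ifs with h
    · refine Finset.sum_congr rfl fun σ _ => ?_
      split_ifs with h'
      · rfl
      · exact T.localInt_eq_zero fun h'' => h' h''.2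
    · exact Finset.sum_eq_zero fun σ _ => T.localInt_eq_zero fun h'' => h h''.1
  have hE := T.errMax_nonneg (K := K) (α := α) Q
  rw [pertEntry, hsum, ← mul_sub, ← Finset.sum_sub_distrib, abs_mul,
    abs_of_nonneg (inv_nonneg.2 (zero_le_one.trans hΓ))]
  simp only [← Finset.sum_sub_distrib]
  calc _ ≤ 1 * ∑ τ : Fin T.N with i ∈ T.idx m τ, ∑ σ : Fin T.N with j ∈ T.idx m σ,
        T.errMax K α m Q := by
        refine mul_le_mul (inv_le_one_of_one_le₀ hΓ) ?_ (abs_nonneg _) zero_le_one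
        refine (Finset.abs_sum_le_sum_abs _ _).trans (Finset.sum_le_sum fun τ hτ => ?_)
        refine (Finset.abs_sum_le_sum_abs _ _).trans (Finset.sum_le_sum fun σ hσ => ?_)
        exact T.abs_localInt_sub_le Q (Finset.mem_filter.1 hτ).2 (Finset.mem_filter.1 hσ).2
    _ = _ := by
        simp only [Finset.sum_const, nsmul_eq_mul, Finset.sum_boole]
        ring

open Classical in
/-- The `ℓ¹` norm of the nodal values, counted once per element. -/
lemma sum_norm_node_le {m : ℕ} {C : ℝ} (hC : 0 < C)
    (hCb : PolynomialBounds 𝕜 m C)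
    {u : ℝ → 𝕜} (hu : u ∈ T.feSpace 𝕜 m) :
    ∑ i : Fin (T.dim m), ‖u (T.node m i)‖ *
        (∑ τ : Fin T.N, if i ∈ T.idx m τ then (1 : ℝ) else 0) ≤
      (m + 1) * Real.sqrt C * (T.Cqu / T.h) * l2norm u := by
  have hq : 0 ≤ T.Cqu / T.h := div_nonneg (by linarith [T.one_le_Cqu]) T.h_pos.le
  set E : Fin T.N → ℝ := fun τ => ∫ t in T.piece τ, ‖u t‖ ^ 2 with hE
  have hE0 : ∀ τ, 0 ≤ E τ := fun τ => integral_nonneg fun t => sq_nonneg _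
  have hnode : ∀ (τ : Fin T.N) (i : Fin (T.dim m)), i ∈ T.idx m τ →
      ‖u (T.node m i)‖ ≤ Real.sqrt C * (Real.sqrt (T.len τ)⁻¹ * Real.sqrt (E τ)) := by
    intro τ i hi
    obtain ⟨p, hp, hpu⟩ := hu.1 τ
    have hi' := T.mem_localDofs_of_mem_idx hi
    have hI : E τ = ∫ t in T.piece τ, ‖p.eval (t : 𝕜)‖ ^ 2 :=
      setIntegral_congr_fun (T.measurableSet_piece τ) fun t ht => by simp only [hpu t ht]
    have hmem := T.node_mem_elem τ hi'
    rw [← Real.sqrt_mul (inv_nonneg.2 (T.len_pos τ).le), ← Real.sqrt_mul hC.le,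
      T.eq_eval_node hu τ hpu hi', hI]
    refine Real.le_sqrt_of_sq_le ?_
    rw [← mul_assoc, ← div_eq_mul_inv]
    exact (hCb p hp _ _ (T.x_lt τ τ.2) _ hmem _ hmem).1
  have hcard : ∀ τ : Fin T.N,
      ((Finset.univ.filter fun i : Fin (T.dim m) => i ∈ T.idx m τ).card : ℝ) ≤ m + 1 := by
    intro τ
    rw [← Nat.cast_succ, Nat.succ_eq_add_one, ← card_localDofs m τ, Nat.cast_le]
    refine Finset.card_le_card_of_injOn (fun i => (i : ℕ)) (fun i hi => ?_)
      (fun i _ j _ h => Fin.ext h)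
    exact T.mem_localDofs_of_mem_idx (Finset.mem_filter.1 hi).2
  have hcs : ∑ τ, Real.sqrt (T.len τ)⁻¹ * Real.sqrt (E τ) ≤ T.Cqu / T.h * l2norm u := by
    -- Cauchy–Schwarz over the elements.
    refine (Real.sum_sqrt_mul_sqrt_le _ (fun τ => inv_nonneg.2 (T.len_pos τ).le) hE0).trans ?_
    have h1 : Real.sqrt (∑ τ, (T.len τ)⁻¹) ≤ T.Cqu / T.h :=
      Real.sqrt_le_iff.2 ⟨hq, T.sum_inv_len_le⟩
    have h2 : Real.sqrt (∑ τ, E τ) = l2norm u := by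
      rw [l2norm, T.integral_Om (T.integrableOn_norm_sq_of_mem_feSpace hu)]
    rw [h2]
    exact mul_le_mul_of_nonneg_right h1 (l2norm_nonneg u)
  calc ∑ i : Fin (T.dim m), ‖u (T.node m i)‖ *
        (∑ τ : Fin T.N, if i ∈ T.idx m τ then (1 : ℝ) else 0)
      = ∑ τ : Fin T.N, ∑ i : Fin (T.dim m) with i ∈ T.idx m τ, ‖u (T.node m i)‖ := by
        simp only [Finset.mul_sum, mul_ite, mul_one, mul_zero]
        rw [Finset.sum_comm]
        simp only [Finset.sum_filter]
    _ ≤ ∑ τ : Fin T.N, (m + 1) *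
          (Real.sqrt C * (Real.sqrt (T.len τ)⁻¹ * Real.sqrt (E τ))) := by
        refine Finset.sum_le_sum fun τ _ => ?_
        refine (Finset.sum_le_sum fun i hi => hnode τ i (Finset.mem_filter.1 hi).2).trans ?_
        rw [Finset.sum_const, nsmul_eq_mul]
        exact mul_le_mul_of_nonneg_right (hcard τ) (by positivity)
    _ = (m + 1) * Real.sqrt C * ∑ τ, Real.sqrt (T.len τ)⁻¹ * Real.sqrt (E τ) := by
        rw [Finset.mul_sum]
        exact Finset.sum_congr rfl fun τ _ => by ring
    _ ≤ (m + 1) * Real.sqrt C * (T.Cqu / T.h * l2norm u) := by gcongr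
    _ = _ := by ring

/-- The consistency estimate in the `L²(Ω)` norm. -/
lemma norm_abelForm_sub_pertForm_le {m : ℕ} {C : ℝ} (hC : 0 < C)
    (hCb : PolynomialBounds 𝕜 m C)
    (hα : α ∈ Ioo (0 : ℝ) 1)
    (hK : IntegrableOn (fun p : ℝ × ℝ => (p.1 - p.2) ^ (α - 1) * K p.1 p.2) triangle)
    (Q : T.LocalQuad m) {u v : ℝ → 𝕜} (hu : u ∈ T.feSpace 𝕜 m) (hv : v ∈ T.feSpace 𝕜 m) :
    ‖abelForm K α u v - T.pertForm α m Q u v‖ ≤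
      T.errMax K α m Q * ((m + 1) ^ 2 * C) * (T.Cqu / T.h) ^ 2 * l2norm u * l2norm v := by
  classical
  have hE := T.errMax_nonneg (K := K) (α := α) Q
  have hq : 0 ≤ T.Cqu / T.h := div_nonneg (by linarith [T.one_le_Cqu]) T.h_pos.le
  rw [T.abelForm_eq_sum hK hu hv, pertForm, ← Finset.sum_sub_distrib]
  simp only [← Finset.sum_sub_distrib]
  set n : Fin (T.dim m) → ℝ := fun i => ∑ τ : Fin T.N, if i ∈ T.idx m τ then (1 : ℝ) else 0
    with hn
  have hn0 : ∀ i, 0 ≤ n i := fun i => Finset.sum_nonneg fun τ _ => by split_ifs <;> norm_num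
  have hterm : ∀ i j : Fin (T.dim m),
      ‖(starRingEnd 𝕜) (v (T.node m i)) *
          (((Real.Gamma α)⁻¹ * ∑ τ, ∑ σ, T.localInt K α m τ σ i j : ℝ) : 𝕜) * u (T.node m j) -
        (starRingEnd 𝕜) (v (T.node m i)) * (T.pertEntry α m Q i j : 𝕜) * u (T.node m j)‖ ≤
      T.errMax K α m Q * ((‖v (T.node m i)‖ * n i) * (‖u (T.node m j)‖ * n j)) := by
    intro i j
    rw [← sub_mul, ← mul_sub, ← RCLike.ofReal_sub, norm_mul, norm_mul, RCLike.norm_conj,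
      RCLike.norm_ofReal]
    have h1 := T.abs_sum_localInt_sub_pertEntry_le (K := K) hα Q i j
    calc _ ≤ ‖v (T.node m i)‖ * (T.errMax K α m Q * n i * n j) * ‖u (T.node m j)‖ := by gcongr
      _ = _ := by ring
  refine (norm_sum_le_of_le _ fun i _ => norm_sum_le_of_le _ fun j _ => hterm i j).trans ?_
  have hsum : ∑ i : Fin (T.dim m), ∑ j : Fin (T.dim m),
        T.errMax K α m Q * ((‖v (T.node m i)‖ * n i) * (‖u (T.node m j)‖ * n j)) =
      T.errMax K α m Q * ((∑ i : Fin (T.dim m), ‖v (T.node m i)‖ * n i) *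
        ∑ j : Fin (T.dim m), ‖u (T.node m j)‖ * n j) := by
    rw [Finset.sum_mul_sum, Finset.mul_sum]
    exact Finset.sum_congr rfl fun i _ => (Finset.mul_sum _ _ _).symm
  have hu' := T.sum_norm_node_le hC hCb hu
  have hv' := T.sum_norm_node_le hC hCb hv
  rw [hsum]
  have hl := l2norm_nonneg v
  have h0 : 0 ≤ ∑ j : Fin (T.dim m), ‖u (T.node m j)‖ * n j :=
    Finset.sum_nonneg fun j _ => mul_nonneg (norm_nonneg _) (hn0 j)
  calc _ ≤ T.errMax K α m Q * (((m + 1) * Real.sqrt C * (T.Cqu / T.h) * l2norm v) *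
        ((m + 1) * Real.sqrt C * (T.Cqu / T.h) * l2norm u)) := by
        refine mul_le_mul_of_nonneg_left (mul_le_mul hv' hu' h0 (by positivity)) hE
    _ = T.errMax K α m Q * ((m + 1) ^ 2 * Real.sqrt C ^ 2) * (T.Cqu / T.h) ^ 2 *
        l2norm u * l2norm v := by ring
    _ = _ := by rw [Real.sq_sqrt hC.le]

end Decomposition

end Mesh

end AbelFEM

/-! ### Choice of the constants and conclusion -/

theorem mainTheorem8 {𝕜 : Type*} [RCLike 𝕜] :
    ∃ (Cm : ℕ → ℝ) (Cinv : ℝ → ℕ → ℝ → ℝ → ℝ),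
      (∀ m, 0 < Cm m) ∧ (∀ s m c q, 0 < Cinv s m c q) ∧
      -- `Cinv s m C_𝒯 C_qu` is a constant of the inverse inequality
      (∀ (s : ℝ), s ∈ Set.Ioo (0 : ℝ) (1 / 2) → ∀ (m : ℕ) (T : AbelFEM.Mesh),
        ∀ u ∈ T.feSpace 𝕜 m,
          AbelFEM.l2norm u ≤ Cinv s m T.CT T.Cqu * T.h ^ (-s) * AbelFEM.HsDualNorm s u) ∧
      -- the consistency estimate
      (∀ (α : ℝ), α ∈ Set.Ioo (0 : ℝ) 1 → ∀ (m : ℕ) (T : AbelFEM.Mesh) (K : ℝ → ℝ → ℝ),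
        MeasureTheory.IntegrableOn (fun p : ℝ × ℝ => (p.1 - p.2) ^ (α - 1) * K p.1 p.2)
          {p : ℝ × ℝ | 0 < p.2 ∧ p.2 < p.1 ∧ p.1 < 1} →
        ∀ (Q : T.LocalQuad m), ∀ u ∈ T.feSpace 𝕜 m, ∀ v ∈ T.feSpace 𝕜 m,
          ‖AbelFEM.abelForm K α u v - T.pertForm α m Q u v‖ ≤
            (Cm m * T.Cqu * Cinv (α / 2) m T.CT T.Cqu ^ 2 * T.errMax K α m Q) *
              T.h ^ (-2 - α) *
              AbelFEM.HsDualNorm (α / 2) u * AbelFEM.HsDualNorm (α / 2) v) := by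
  choose C hC hCb using AbelFEM.exists_polynomialBounds 𝕜
  set C₁ : ℝ → ℕ → ℝ → ℝ := fun s m q =>
    Real.sqrt (1 + C m * (1 + 4 / (s * (1 - 2 * s))) * q ^ (2 * s)) with hC₁
  -- The maxima with 1 give positivity for all arguments. The extra factor `max 1 q` only weakens
  -- the inverse inequality, but `Cinv²` then supplies the `C_qu²` of the `L²` consistency estimate.
  set Cinv : ℝ → ℕ → ℝ → ℝ → ℝ := fun s m _ q => max 1 (C₁ s m q) * max 1 q with hCinv
  have hpos : ∀ s m c q, 0 < Cinv s m c q := fun s m c q =>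
    mul_pos (lt_max_of_lt_left one_pos) (lt_max_of_lt_left one_pos)
  have hinv : ∀ (s : ℝ), s ∈ Set.Ioo (0 : ℝ) (1 / 2) → ∀ (m : ℕ) (T : AbelFEM.Mesh),
      ∀ u ∈ T.feSpace 𝕜 m, AbelFEM.l2norm u ≤
        max 1 (C₁ s m T.Cqu) * T.h ^ (-s) * AbelFEM.HsDualNorm s u := by
    intro s hs m T u hu
    have hh := Real.rpow_pos_of_pos T.h_pos (-s)
    have hd := AbelFEM.HsDualNorm_nonneg s u
    refine (T.l2norm_le_HsDualNorm hs.1 hs.2 (hC m) (hCb m) hu).trans ?_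
    gcongr
    exact le_max_right _ _
  refine ⟨fun m => (m + 1) ^ 2 * C m, Cinv, fun m => mul_pos (by positivity) (hC m), hpos, ?_, ?_⟩
  · intro s hs m T u hu
    have hh := Real.rpow_pos_of_pos T.h_pos (-s)
    have hd := AbelFEM.HsDualNorm_nonneg s u
    refine (hinv s hs m T u hu).trans ?_
    gcongr
    exact le_mul_of_one_le_right (zero_le_one.trans (le_max_left _ _)) (le_max_left _ _)
  · intro α hα m T K hK Q u hu v hv
    have hs : α / 2 ∈ Set.Ioo (0 : ℝ) (1 / 2) := ⟨by linarith [hα.1], by linarith [hα.2]⟩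
    have hE := T.errMax_nonneg (K := K) (α := α) Q
    have hh := T.h_pos
    have hq := T.one_le_Cqu
    have hCm := hC m
    have hdu := AbelFEM.HsDualNorm_nonneg (α / 2) u
    have hdv := AbelFEM.HsDualNorm_nonneg (α / 2) v
    have hu' := hinv (α / 2) hs m T u hu
    have hv' := hinv (α / 2) hs m T v hv
    have hlu := AbelFEM.l2norm_nonneg u
    have hlv := AbelFEM.l2norm_nonneg v
    have hpow : T.h ^ (-2 - α) = (T.h ^ (-(α / 2))) ^ 2 / T.h ^ 2 := by
      rw [← Real.rpow_natCast (T.h ^ (-(α / 2))), ← Real.rpow_mul hh.le, ← Real.rpow_natCast T.h 2,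
        ← Real.rpow_sub hh]
      congr 1
      push_cast
      ring
    set M := max 1 (C₁ (α / 2) m T.Cqu) with hM
    have hM0 : 0 < M := lt_max_of_lt_left one_pos
    have hmax : max 1 T.Cqu = T.Cqu := max_eq_right hq
    have hCi : Cinv (α / 2) m T.CT T.Cqu = M * T.Cqu := by rw [hCinv]; simp only [hmax, hM]
    rw [hCi, hpow]
    set H := T.h ^ (-(α / 2)) with hH
    have hH0 : 0 < H := Real.rpow_pos_of_pos hh _
    calc _ ≤ T.errMax K α m Q * ((m + 1) ^ 2 * C m) * (T.Cqu / T.h) ^ 2 *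
          AbelFEM.l2norm u * AbelFEM.l2norm v :=
          T.norm_abelForm_sub_pertForm_le (hC m) (hCb m) hα hK Q hu hv
      _ ≤ T.errMax K α m Q * ((m + 1) ^ 2 * C m) * (T.Cqu / T.h) ^ 2 *
          (M * H * AbelFEM.HsDualNorm (α / 2) u) * (M * H * AbelFEM.HsDualNorm (α / 2) v) := by
          gcongr
      _ = ((m + 1) ^ 2 * C m * T.Cqu ^ 2 * M ^ 2 * T.errMax K α m Q * (H ^ 2 / T.h ^ 2) *
          AbelFEM.HsDualNorm (α / 2) u * AbelFEM.HsDualNorm (α / 2) v) * 1 := by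
          ring
      -- `Cinv²` already contains `C_qu²`; the explicit factor `C_qu ≥ 1` of the claimed bound is
      -- surplus.
      _ ≤ ((m + 1) ^ 2 * C m * T.Cqu ^ 2 * M ^ 2 * T.errMax K α m Q * (H ^ 2 / T.h ^ 2) *
          AbelFEM.HsDualNorm (α / 2) u * AbelFEM.HsDualNorm (α / 2) v) * T.Cqu := by
          have : 0 ≤ T.Cqu := by linarith
          gcongr
      _ = _ := by ring
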